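/- Let $P_{11}\subset\mathbb H^3$ be a right-angled ideal polyhedron (a set with nonempty interior that is the convex hull of finitely many points at infinity, any two adjacent faces of which are orthogonal) with a checkerboard coloring of its faces, i.e. each face is black or white and adjacent faces have different colors. Reflecting a polyhedron $P$ across one of its faces $f$ means replacing it by $P\cup\phi_f(P)$, where $\phi_f$ is the reflection in the plane of $f$; a face of a larger polyhedron that contains a face $f'$ of $P$, or $\phi_f(f')$, has it as a subface and inherits the color of $f'$. Let $$P_{11},\,P_{12},\,\dots,\,P_{1k_1}=P_{21},\,\dots,\,P_{2k_2}=P_{31},\,\dots,\,P_{nk_n}=P_{(n+1)1},\,\dots$$ be a sequence of polyhedra, each obtained from the preceding one by reflection across one of its faces ($P_{n(j+1)}$ from $P_{nj}$ across a face $f_{nj}$, $1\le j<k_n$), such that (i) the colors of the faces used alternate along the whole sequence, starting with black; (ii) whenever $P_{nj}$ has a face of the prescribed color that is, or contains as a subface, a face of $P_{n1}$, the face $f_{nj}$ is of this kind; (iii) for every $n$, no face of $P_{n1}$ is a subface of (i.e. is contained in) a face of $P_{nk_n}$. Let $G_{ij}$ be the group generated by the reflections in the faces of $P_{ij}$. Then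 $$\bigcap_{i,j}G_{ij}=\{1\}.$$ Consequently, let $M_{11}=\mathbb H^3/\Gamma$ be a hyperbolic $3$-manifold, where $\Gamma=\pi_1(M_{11})$ is a subgroup of finite index of $G_{11}$ acting freely on $\mathbb H^3$. Then the natural maps $M_{ij}=\mathbb H^3/(\Gamma\cap G_{ij})\to M_{11}$ are covering maps, there is an isomorphism $\pi_1(M_{11})\cong\Gamma$ that takes the image of $\pi_1(M_{ij})$ to $\Gamma\cap G_{ij}$ for all $i,j$, and the family of covers is co-final: the subgroups $\pi_1(M_{ij})=\pi_1(M_{11})\cap G_{ij}$ have finite index in $\pi_1(M_{11})$ and trivial intersection. -/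

import Mathlib

noncomputable section

namespace RAPoly

/-! ### Hyperbolic 3-space (hyperboloid model) -/

/-- The underlying vector space of Minkowski space `ℝ^{1,3}`. -/
abbrev Mink : Type := Fin 4 → ℝ

/-- The Lorentz form of signature `(-,+,+,+)`. -/
def mink (x y : Mink) : ℝ := -(x 0 * y 0) + x 1 * y 1 + x 2 * y 2 + x 3 * y 3

/-- Hyperbolic 3-space: the upper sheet of the hyperboloid `⟨x, x⟩ = -1`. -/
abbrev H3 : Type := {x : Mink // mink x x = -1 ∧ 0 < x 0}

/-- Unit spacelike vectors. Such a vector `e` encodes a hyperplane of hyperbolic space together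
with a choice of one of its two sides. -/
abbrev Spacelike : Type := {e : Mink // mink e e = 1}

/-- The hyperplane `e^⊥`. -/
def wall (e : Spacelike) : Set H3 := {x | mink x.1 e.1 = 0}

/-- The closed half-space bounded by `wall e` for which `e` is the outward normal. -/
def halfSpace (e : Spacelike) : Set H3 := {x | mink x.1 e.1 ≤ 0}

/-- The Lorentz reflection in `e^⊥`. -/
def reflVec (e : Spacelike) (x : Mink) : Mink := x - (2 * mink x e.1) • e.1

theorem reflVec_reflVec (e : Spacelike) (x : Mink) : reflVec e (reflVec e x) = x := by
  obtain ⟨e, he⟩ := e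
  have h : mink (x - (2 * mink x e) • e) e = - mink x e := by
    have : mink (x - (2 * mink x e) • e) e = mink x e - 2 * mink x e * mink e e := by
      simp only [mink, Pi.sub_apply, Pi.smul_apply, smul_eq_mul]; ring
    rw [this, he]; ring
  simp only [reflVec, h]
  ext i
  simp

theorem mink_reflVec_self (e : Spacelike) (x : Mink) :
    mink (reflVec e x) (reflVec e x) = mink x x := by
  obtain ⟨e, he⟩ := e
  have : mink (reflVec ⟨e, he⟩ x) (reflVec ⟨e, he⟩ x)
      = mink x x - 4 * mink x e ^ 2 + 4 * mink x e ^ 2 * mink e e := by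
    simp only [reflVec, mink, Pi.sub_apply, Pi.smul_apply, smul_eq_mul]; ring
  rw [this, he]; ring

theorem reflVec_zero_pos (e : Spacelike) (x : H3) : 0 < reflVec e x.1 0 := by
  obtain ⟨x, hx, hx0⟩ := x
  have hy := mink_reflVec_self e x
  rw [hx] at hy
  have hxy : mink x (reflVec e x) = -1 - 2 * mink x e.1 ^ 2 := by
    have : mink x (reflVec e x) = mink x x - 2 * mink x e.1 ^ 2 := by
      simp only [reflVec, mink, Pi.sub_apply, Pi.smul_apply, smul_eq_mul]; ring
    rw [this, hx]
  change 0 < reflVec e x 0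
  generalize reflVec e x = y at *
  by_contra hneg
  push Not at hneg
  have hlt : mink x y < 0 := by rw [hxy]; nlinarith [sq_nonneg (mink x e.1)]
  simp only [mink] at hx hy hlt
  have h1 : (x 1 * y 1 + x 2 * y 2 + x 3 * y 3) ^ 2
      ≤ (x 1 ^ 2 + x 2 ^ 2 + x 3 ^ 2) * (y 1 ^ 2 + y 2 ^ 2 + y 3 ^ 2) := by
    nlinarith [sq_nonneg (x 1 * y 2 - x 2 * y 1), sq_nonneg (x 1 * y 3 - x 3 * y 1),
      sq_nonneg (x 2 * y 3 - x 3 * y 2)]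
  have h2 : x 1 ^ 2 + x 2 ^ 2 + x 3 ^ 2 = x 0 ^ 2 - 1 := by linarith
  have h3 : y 1 ^ 2 + y 2 ^ 2 + y 3 ^ 2 = y 0 ^ 2 - 1 := by linarith
  rw [h2, h3] at h1
  have h4 : 0 ≤ x 0 * (-y 0) := mul_nonneg hx0.le (by linarith)
  have h5 : x 0 * (-y 0) < -(x 1 * y 1 + x 2 * y 2 + x 3 * y 3) := by linarith
  have h6 : (x 0 * (-y 0)) ^ 2 < (x 1 * y 1 + x 2 * y 2 + x 3 * y 3) ^ 2 := by nlinarith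
  have h7 : 0 ≤ y 1 ^ 2 + y 2 ^ 2 + y 3 ^ 2 := by positivity
  have h8 : 0 ≤ x 1 ^ 2 + x 2 ^ 2 + x 3 ^ 2 := by positivity
  nlinarith

/-- The hyperbolic reflection in the hyperplane `wall e`. -/
def reflection (e : Spacelike) : Equiv.Perm H3 where
  toFun x := ⟨reflVec e x.1, (mink_reflVec_self e x.1).trans x.2.1, reflVec_zero_pos e x⟩
  invFun x := ⟨reflVec e x.1, (mink_reflVec_self e x.1).trans x.2.1, reflVec_zero_pos e x⟩
  left_inv x := Subtype.ext (reflVec_reflVec e x.1)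
  right_inv x := Subtype.ext (reflVec_reflVec e x.1)

/-! ### Right-angled ideal polyhedra -/

/-- `P` is an ideal polyhedron: a set with nonempty interior that is the hyperbolic convex hull of
finitely many points at infinity, the latter being represented by future lightlike vectors. -/
def IsIdealPolyhedron (P : Set H3) : Prop :=
  (interior P).Nonempty ∧
  ∃ S : Finset Mink, (∀ v ∈ S, mink v v = 0 ∧ 0 < v 0) ∧
    ∀ x : H3, x ∈ P ↔ ∃ c : Mink → ℝ, (∀ v ∈ S, 0 ≤ c v) ∧ x.1 = ∑ v ∈ S, c v • v

/-- The part of `P` on the hyperplane `wall e`; it is a face of `P` when `e ∈ faceNormals P`. -/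
def face (P : Set H3) (e : Spacelike) : Set H3 := P ∩ wall e

/-- The outward unit normals of the (two-dimensional) faces of `P`: the supporting half-spaces of
`P` whose bounding plane meets `P` in a set spanning that plane. -/
def faceNormals (P : Set H3) : Set Spacelike :=
  {e | P ⊆ halfSpace e ∧
    Module.finrank ℝ (Submodule.span ℝ ((fun x : H3 => x.1) '' face P e)) = 3}

/-- Two distinct faces are adjacent if they meet inside hyperbolic space. (Ideal polyhedra have no
vertices inside hyperbolic space, so such faces share an edge.) -/
def Adjacent (P : Set H3) (e e' : Spacelike) : Prop :=
  e ≠ e' ∧ (face P e ∩ face P e').Nonempty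

/-- All dihedral angles are `π / 2`. -/
def IsRightAngled (P : Set H3) : Prop :=
  ∀ e ∈ faceNormals P, ∀ e' ∈ faceNormals P, Adjacent P e e' → mink e.1 e'.1 = 0

inductive Color : Type
  | black
  | white

/-- A checkerboard coloring of the faces: adjacent faces have different colors. Only the values
at outward normals of faces of `P` matter. -/
def IsCheckerboard (P : Set H3) (col : Spacelike → Color) : Prop :=
  ∀ e ∈ faceNormals P, ∀ e' ∈ faceNormals P, Adjacent P e e' → col e ≠ col e'

/-- The reflection group of `P`, generated by the reflections in its faces. -/
def reflectionGroup (P : Set H3) : Subgroup (Equiv.Perm H3) :=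
  Subgroup.closure (reflection '' faceNormals P)

/-- The face of `Q` with outward normal `e` is a face of `P` or contains a face of `P` as a
subface. -/
def HasSubface (P Q : Set H3) (e : Spacelike) : Prop :=
  ∃ e₀ ∈ faceNormals P, face P e₀ ⊆ face Q e

/-- The color prescribed for the `m`-th reflection: black and white alternate, black first. -/
def turn (m : ℕ) : Color := if Even m then Color.black else Color.white

/-- The number of reflections performed before stage `i`, if stage `l` performs `k l` of them. -/
def stageStart (k : ℕ → ℕ) (i : ℕ) : ℕ := ∑ l ∈ Finset.range i, k l

/-- A sequence of polyhedra `poly 0, poly 1, …` obtained from a checkerboard colored right-angled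
ideal polyhedron `poly 0` by successive reflections across faces of alternating color, and
subdivided into stages: stage `i` performs `k i` reflections. -/
structure Construction where
  /-- all the polyhedra, in the order in which they are constructed -/
  poly : ℕ → Set H3
  /-- the colors of the faces of `poly m` -/
  color : ℕ → Spacelike → Color
  /-- the outward normal of the face of `poly m` across which `poly m` is reflected -/
  mirror : ℕ → Spacelike
  /-- the number of reflections in each stage -/
  k : ℕ → ℕ
  ideal : IsIdealPolyhedron (poly 0)
  rightAngled : IsRightAngled (poly 0)
  checkerboard : IsCheckerboard (poly 0) (color 0)
  mirror_mem : ∀ m, mirror m ∈ faceNormals (poly m)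
  poly_succ : ∀ m, poly (m + 1) = poly m ∪ reflection (mirror m) '' poly m
  /-- a face of `poly (m + 1)` has the color of its subfaces `f` and `φ(f)`, where `f` is a face
  of `poly m` and `φ` is the `m`-th reflection -/
  color_succ : ∀ m, ∀ e ∈ faceNormals (poly m), ∀ e' ∈ faceNormals (poly (m + 1)),
    face (poly m) e ⊆ face (poly (m + 1)) e' ∨
      reflection (mirror m) '' face (poly m) e ⊆ face (poly (m + 1)) e' →
    color (m + 1) e' = color m e
  /-- the reflections alternate between black and white faces -/
  alternating : ∀ m, color m (mirror m) = turn m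
  /-- during stage `i`, whenever a face of the prescribed color contains a face of the first
  polyhedron of the stage, the reflection is performed across such a face -/
  whenever_possible : ∀ i, ∀ j < k i,
    (∃ e ∈ faceNormals (poly (stageStart k i + j)),
      color (stageStart k i + j) e = turn (stageStart k i + j) ∧
      HasSubface (poly (stageStart k i)) (poly (stageStart k i + j)) e) →
    HasSubface (poly (stageStart k i)) (poly (stageStart k i + j))
      (mirror (stageStart k i + j))
  /-- no face of the first polyhedron of a stage is a subface of the last one -/
  absorbed : ∀ i, ∀ e ∈ faceNormals (poly (stageStart k (i + 1))),
    ¬ HasSubface (poly (stageStart k i)) (poly (stageStart k (i + 1))) e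

namespace Construction

/-- The pairs `(i, j)` with `0 ≤ j ≤ k i`. -/
abbrev Idx (C : Construction) : Type := Σ i : ℕ, Fin (C.k i + 1)

/-- The `j`-th polyhedron of the `i`-th stage (both counted from `0`). The last polyhedron of a
stage is the first one of the next stage. -/
def P (C : Construction) (p : C.Idx) : Set H3 :=
  C.poly (stageStart C.k p.1 + (p.2 : ℕ))

/-- The reflection group of the `j`-th polyhedron of the `i`-th stage. -/
def G (C : Construction) (p : C.Idx) : Subgroup (Equiv.Perm H3) := reflectionGroup (C.P p)

end Construction

/-! ### Quotients of hyperbolic space, covers, co-final families -/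

/-- `Γ` acts freely on hyperbolic space. -/
def ActsFreely (Γ : Subgroup (Equiv.Perm H3)) : Prop :=
  ∀ g ∈ Γ, ∀ x : H3, g x = x → g = 1

/-- The orbit space `H3 / Γ`. -/
abbrev HypQuotient (Γ : Subgroup (Equiv.Perm H3)) : Type := Quotient (MulAction.orbitRel Γ H3)

/-- The image in `H3 / Γ` of a point of hyperbolic space. -/
def proj (Γ : Subgroup (Equiv.Perm H3)) (x : H3) : HypQuotient Γ := Quotient.mk _ x

/-- The natural map `H3 / Γ' → H3 / Γ` for `Γ' ≤ Γ`. -/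
def coverMap {Γ' Γ : Subgroup (Equiv.Perm H3)} (h : Γ' ≤ Γ) :
    C(HypQuotient Γ', HypQuotient Γ) where
  toFun := Quotient.lift (proj Γ) (by
    rintro a b ⟨g, rfl⟩
    exact Quotient.sound ⟨⟨g.1, h g.2⟩, rfl⟩)
  continuous_toFun := continuous_quot_mk.quotient_lift _

/-- The subgroup of `π₁(H3 / Γ)` formed by `π₁(H3 / Γ')`, for the natural map
`H3 / Γ' → H3 / Γ` and the base points given by `x`. -/
def coverPi1 {Γ' Γ : Subgroup (Equiv.Perm H3)} (h : Γ' ≤ Γ) (x : H3) :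
    Subgroup (FundamentalGroup (HypQuotient Γ) (proj Γ x)) :=
  (FundamentalGroup.mapOfEq (coverMap h) (x := proj Γ' x) (y := proj Γ x) rfl).range

/-- A co-final family: finite index subgroups with trivial intersection. -/
def IsCofinal {G ι : Type} [Group G] (H : ι → Subgroup G) : Prop :=
  (∀ i, (H i).FiniteIndex) ∧ (⨅ i, H i) = ⊥

end RAPoly

end

noncomputable section

namespace RAPoly

/-! ### Algebra of the Lorentz form -/

/-! The geometric input is that a right-angled ideal polyhedron is a Coxeter chamber: two distinct
outward normals satisfy ⟨e, e'⟩ = 0 or ⟨e, e'⟩ ≤ -1 (`exists_isChamber`). Two half-spaces violated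
at the same point are then orthogonal, so folding points across violated walls is confluent, with
the points of the chamber as normal forms. Hence points of the chamber in one orbit coincide
(`IsChamber.apply_eq_self`), and only the identity maps the base point x₀ into the chamber
(`IsChamber.eq_one_of_apply_mem`). Doubling a chamber across a wall gives a chamber with the same
base point (`IsChamber.double`), so this applies to every polyhedron of the sequence and its own
reflection group; these groups decrease.

The polyhedra exhaust the orbit of x₀ under the initial group. Suppose that g x₀ lies in the first
polyhedron of a stage but its neighbour g r_e x₀, for a face e of the initial polyhedron, does not
lie in the last one. Then each of the two polyhedra has a wall separating these points. All walls
are mirrors of the initial group, and only one mirror separates neighbours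
(`IsChamber.eq_of_mirror_separates`), so the two polyhedra share a wall, which `absorbed` excludes.
By induction on word length every g x₀ lies in some polyhedron. If g belongs to all the groups, it
belongs to the group of that polyhedron, and so g = 1.

For the covers, each doubling has index at most two, which gives finite index. The orbit of x₀ is
uniformly discrete, so a freely acting Γ acts as a deck group on the contractible space `H3`;
lifting loops identifies the fundamental group with Γ and the subgroup of each intermediate cover
with the intersection. -/

theorem mink_comm (u v : Mink) : mink u v = mink v u := by simp only [mink]; ring

/-- The linear form `x ↦ ⟨x, e⟩`. -/
def minkForm (e : Mink) : Mink →ₗ[ℝ] ℝ where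
  toFun x := mink x e
  map_add' x y := by simp only [mink, Pi.add_apply]; ring
  map_smul' c x := by simp only [mink, Pi.smul_apply, smul_eq_mul, RingHom.id_apply]; ring

@[simp] theorem minkForm_apply (e x : Mink) : minkForm e x = mink x e := rfl

theorem mink_add_left (u v w : Mink) : mink (u + v) w = mink u w + mink v w :=
  (minkForm w).map_add u v

theorem mink_sub_left (u v w : Mink) : mink (u - v) w = mink u w - mink v w :=
  (minkForm w).map_sub u v

theorem mink_neg_left (u w : Mink) : mink (-u) w = -mink u w := (minkForm w).map_neg u

theorem mink_smul_left (c : ℝ) (u w : Mink) : mink (c • u) w = c * mink u w :=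
  (minkForm w).map_smul c u

theorem mink_sum_left {ι : Type*} (s : Finset ι) (f : ι → Mink) (w : Mink) :
    mink (∑ i ∈ s, f i) w = ∑ i ∈ s, mink (f i) w := map_sum (minkForm w) f s

theorem mink_add_right (u v w : Mink) : mink w (u + v) = mink w u + mink w v := by
  simp only [mink_comm w, mink_add_left]

theorem mink_sub_right (u v w : Mink) : mink w (u - v) = mink w u - mink w v := by
  simp only [mink_comm w, mink_sub_left]

theorem mink_neg_right (u w : Mink) : mink w (-u) = -mink w u := by
  simp only [mink_comm w, mink_neg_left]

theorem mink_smul_right (c : ℝ) (u w : Mink) : mink w (c • u) = c * mink w u := by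
  simp only [mink_comm w, mink_smul_left]

/-- Every linear form is represented by a vector. -/
theorem exists_minkForm_eq (f : Mink →ₗ[ℝ] ℝ) : ∃ e : Mink, minkForm e = f := by
  refine ⟨![-f (Pi.single 0 1), f (Pi.single 1 1), f (Pi.single 2 1), f (Pi.single 3 1)], ?_⟩
  refine LinearMap.pi_ext' fun i => LinearMap.ext_ring ?_
  fin_cases i <;> simp [mink]

theorem minkForm_injective : Function.Injective minkForm := by
  intro u v h
  have h' (x : Mink) : mink x u = mink x v := congrArg (fun f : Mink →ₗ[ℝ] ℝ => f x) h
  ext i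
  have := h' (Pi.single i 1)
  fin_cases i <;> simpa [mink] using this

theorem continuous_mink {X : Type*} [TopologicalSpace X] {f g : X → Mink} (hf : Continuous f)
    (hg : Continuous g) : Continuous fun x => mink (f x) (g x) := by
  unfold mink
  fun_prop

theorem mink_spatial_cauchy (u v : Mink) : (u 1 * v 1 + u 2 * v 2 + u 3 * v 3) ^ 2
    ≤ (u 1 ^ 2 + u 2 ^ 2 + u 3 ^ 2) * (v 1 ^ 2 + v 2 ^ 2 + v 3 ^ 2) := by
  nlinarith [sq_nonneg (u 1 * v 2 - u 2 * v 1), sq_nonneg (u 1 * v 3 - u 3 * v 1),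
      sq_nonneg (u 2 * v 3 - u 3 * v 2)]

/-- A future timelike and a future causal vector have negative product. -/
theorem mink_neg_of_timelike_causal {u v : Mink} (hu : mink u u < 0) (hu0 : 0 < u 0)
    (hv : mink v v ≤ 0) (hv0 : 0 < v 0) : mink u v < 0 := by
  have hc := mink_spatial_cauchy u v
  simp only [mink] at *
  by_contra hneg
  push Not at hneg
  have h1 : 0 < u 0 * v 0 := mul_pos hu0 hv0
  have h2 : u 1 ^ 2 + u 2 ^ 2 + u 3 ^ 2 < u 0 ^ 2 := by nlinarith
  have h3 : v 1 ^ 2 + v 2 ^ 2 + v 3 ^ 2 ≤ v 0 ^ 2 := by nlinarith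
  have h4 : (u 0 * v 0) ^ 2 ≤ (u 1 * v 1 + u 2 * v 2 + u 3 * v 3) ^ 2 :=
    pow_le_pow_left₀ h1.le (by linarith) 2
  have h5 : (u 1 ^ 2 + u 2 ^ 2 + u 3 ^ 2) * (v 1 ^ 2 + v 2 ^ 2 + v 3 ^ 2)
      ≤ (u 1 ^ 2 + u 2 ^ 2 + u 3 ^ 2) * v 0 ^ 2 := by gcongr
  have h6 : (u 1 ^ 2 + u 2 ^ 2 + u 3 ^ 2) * v 0 ^ 2 < u 0 ^ 2 * v 0 ^ 2 := by gcongr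
  nlinarith

/-- A nonzero vector orthogonal to a timelike vector is spacelike. -/
theorem mink_self_pos_of_orthogonal {u e : Mink} (hu : mink u u < 0) (he : mink u e = 0)
    (hne : e ≠ 0) : 0 < mink e e := by
  by_contra hneg
  push Not at hneg
  have hc := mink_spatial_cauchy u e
  apply hne
  simp only [mink] at *
  have h2 : u 1 ^ 2 + u 2 ^ 2 + u 3 ^ 2 < u 0 ^ 2 := by nlinarith
  have h3 : e 1 ^ 2 + e 2 ^ 2 + e 3 ^ 2 ≤ e 0 ^ 2 := by nlinarith
  have h4 : u 1 * e 1 + u 2 * e 2 + u 3 * e 3 = u 0 * e 0 := by linarith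
  rw [h4] at hc
  have h5 : (u 1 ^ 2 + u 2 ^ 2 + u 3 ^ 2) * (e 1 ^ 2 + e 2 ^ 2 + e 3 ^ 2)
      ≤ (u 1 ^ 2 + u 2 ^ 2 + u 3 ^ 2) * e 0 ^ 2 := by gcongr
  have h6 : e 0 ^ 2 = 0 := by
    by_contra h
    have h7 : 0 < e 0 ^ 2 := lt_of_le_of_ne (sq_nonneg _) (Ne.symm h)
    have h8 : (u 1 ^ 2 + u 2 ^ 2 + u 3 ^ 2) * e 0 ^ 2 < u 0 ^ 2 * e 0 ^ 2 := by gcongr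
    nlinarith
  have h1 : e 1 ^ 2 = 0 := by nlinarith [sq_nonneg (e 1), sq_nonneg (e 2), sq_nonneg (e 3)]
  have h2 : e 2 ^ 2 = 0 := by nlinarith [sq_nonneg (e 1), sq_nonneg (e 2), sq_nonneg (e 3)]
  have h3 : e 3 ^ 2 = 0 := by nlinarith [sq_nonneg (e 1), sq_nonneg (e 2), sq_nonneg (e 3)]
  ext i
  fin_cases i
  · exact pow_eq_zero_iff two_ne_zero |>.1 h6
  · exact pow_eq_zero_iff two_ne_zero |>.1 h1
  · exact pow_eq_zero_iff two_ne_zero |>.1 h2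
  · exact pow_eq_zero_iff two_ne_zero |>.1 h3

theorem mink_self_nonneg_of_orthogonal {u e : Mink} (hu : mink u u < 0) (he : mink u e = 0) :
    0 ≤ mink e e := by
  by_cases h : e = 0
  · simp [h, mink]
  · exact (mink_self_pos_of_orthogonal hu he h).le

/-- Cauchy–Schwarz on the orthogonal complement of a timelike vector. -/
theorem mink_cauchy_of_orthogonal {u a b : Mink} (hu : mink u u < 0) (ha : mink u a = 0)
    (hb : mink u b = 0) : mink a b ^ 2 ≤ mink a a * mink b b := by
  have h (t : ℝ) : 0 ≤ mink b b * (t * t) + 2 * mink a b * t + mink a a := by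
    have h1 : mink u (a + t • b) = 0 := by
      rw [mink_add_right, mink_smul_right, ha, hb]; ring
    have h2 := mink_self_nonneg_of_orthogonal hu h1
    simp only [mink_add_left, mink_add_right, mink_smul_left, mink_smul_right] at h2
    rw [mink_comm b a] at h2
    linarith
  have := discrim_le_zero h
  rw [discrim] at this
  linarith

theorem mink_self_H3 (x : H3) : mink x.1 x.1 = -1 := x.2.1

theorem mink_self_H3_neg (x : H3) : mink x.1 x.1 < 0 := by rw [mink_self_H3]; norm_num

theorem mink_H3_neg (x y : H3) : mink x.1 y.1 < 0 :=
  mink_neg_of_timelike_causal (mink_self_H3_neg x) x.2.2 (mink_self_H3_neg y).le y.2.2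

/-- A causal vector on the same side as a point of hyperbolic space is future directed. -/
theorem future_of_mink_neg {v : Mink} {x : H3} (hv : mink v v ≤ 0) (hx : mink v x.1 < 0) :
    0 < v 0 := by
  rcases lt_trichotomy (v 0) 0 with h | h | h
  · have := mink_neg_of_timelike_causal (v := -v) (mink_self_H3_neg x) x.2.2
      (by simpa [mink_neg_left, mink_neg_right] using hv) (by simpa using h)
    rw [mink_neg_right, mink_comm] at this
    linarith
  · have hc : v 1 ^ 2 + v 2 ^ 2 + v 3 ^ 2 ≤ 0 := by simp only [mink, h] at hv; nlinarith
    have h1 : v 1 = 0 := by nlinarith [sq_nonneg (v 1), sq_nonneg (v 2), sq_nonneg (v 3)]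
    have h2 : v 2 = 0 := by nlinarith [sq_nonneg (v 1), sq_nonneg (v 2), sq_nonneg (v 3)]
    have h3 : v 3 = 0 := by nlinarith [sq_nonneg (v 1), sq_nonneg (v 2), sq_nonneg (v 3)]
    simp [mink, h, h1, h2, h3] at hx
  · exact h

/-- A future timelike vector is a positive multiple of a point of hyperbolic space. -/
theorem exists_normalize {v : Mink} (hv : mink v v < 0) (hv0 : 0 < v 0) :
    ∃ (x : H3) (c : ℝ), 0 < c ∧ x.1 = c • v := by
  have hs : 0 < -mink v v := by linarith
  have hc : 0 < (Real.sqrt (-mink v v))⁻¹ := inv_pos.2 (Real.sqrt_pos.2 hs)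
  refine ⟨⟨(Real.sqrt (-mink v v))⁻¹ • v, ?_, ?_⟩, _, hc, rfl⟩
  · rw [mink_smul_left, mink_smul_right, ← mul_assoc, ← mul_inv, Real.mul_self_sqrt hs.le,
      inv_neg, neg_mul, inv_mul_cancel₀ hv.ne]
  · simpa using mul_pos hc hv0

theorem timelike_add {u v : Mink} (hu : mink u u < 0) (hu0 : 0 < u 0)
    (hv : mink v v ≤ 0) (hv0 : 0 < v 0) : mink (u + v) (u + v) < 0 := by
  have := mink_neg_of_timelike_causal hu hu0 hv hv0
  simp only [mink_add_left, mink_add_right]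
  rw [mink_comm v u]
  linarith

/-- Positive combinations of two points of hyperbolic space. -/
theorem exists_normalize_add (x y : H3) {t : ℝ} (ht : 0 ≤ t) :
    ∃ (z : H3) (c : ℝ), 0 < c ∧ z.1 = c • (x.1 + t • y.1) := by
  apply exists_normalize
  · have := mink_H3_neg x y
    simp only [mink_add_left, mink_add_right, mink_smul_left, mink_smul_right, mink_self_H3]
    rw [mink_comm y.1 x.1]
    nlinarith [mul_nonneg ht ht, mul_nonneg ht (neg_nonneg.2 this.le)]
  · have := mul_nonneg ht y.2.2.le
    have := x.2.2
    simp only [Pi.add_apply, Pi.smul_apply, smul_eq_mul]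
    linarith

/-- Two unit spacelike vectors with the same orthogonal complement agree up to sign. -/
theorem eq_or_eq_neg_of_ker_le {e e' : Spacelike}
    (h : LinearMap.ker (minkForm e.1) ≤ LinearMap.ker (minkForm e'.1)) :
    e'.1 = e.1 ∨ e'.1 = -e.1 := by
  obtain ⟨c, hc⟩ : ∃ c : ℝ, minkForm e'.1 = c • minkForm e.1 := by
    refine ⟨mink e.1 e'.1, LinearMap.ext fun x => ?_⟩
    have hx : x - mink x e.1 • e.1 ∈ LinearMap.ker (minkForm e.1) := by
      simp [mink_sub_left, mink_smul_left, e.2]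
    have := h hx
    simp only [LinearMap.mem_ker, minkForm_apply, mink_sub_left, mink_smul_left] at this
    simp only [minkForm_apply, LinearMap.smul_apply, smul_eq_mul]
    linarith
  have hv : e'.1 = c • e.1 := by
    apply minkForm_injective
    rw [hc]
    exact LinearMap.ext fun x => (mink_smul_right c e.1 x).symm
  have h1 := e'.2
  rw [hv, mink_smul_left, mink_smul_right, e.2] at h1
  have : (c - 1) * (c + 1) = 0 := by linarith
  rcases mul_eq_zero.1 this with h | h
  · left; rw [hv, sub_eq_zero.1 h, one_smul]
  · right; rw [hv, eq_neg_of_add_eq_zero_left h, neg_one_smul]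

theorem finrank_ker_minkForm {e : Mink} (he : e ≠ 0) :
    Module.finrank ℝ (LinearMap.ker (minkForm e)) = 3 := by
  have hne : minkForm e ≠ 0 := by
    intro h
    apply he
    apply minkForm_injective
    rw [h]
    exact LinearMap.ext fun x => by simp [mink]
  have h1 := Module.Dual.finrank_ker_add_one_of_ne_zero (f := minkForm e) hne
  have h2 : Module.finrank ℝ Mink = 4 := by simp
  omega

theorem Spacelike.ne_zero (e : Spacelike) : e.1 ≠ 0 := by
  intro h
  have := e.2
  rw [h] at this
  simp [mink] at this

/-! ### Reflections and isometries -/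

theorem mink_reflVec_left (e : Spacelike) (x y : Mink) :
    mink (reflVec e x) y = mink x y - 2 * mink x e.1 * mink e.1 y := by
  rw [reflVec, mink_sub_left, mink_smul_left]

theorem mink_reflVec_reflVec (e : Spacelike) (x y : Mink) :
    mink (reflVec e x) (reflVec e y) = mink x y := by
  rw [mink_reflVec_left, reflVec, mink_sub_right, mink_sub_right, mink_smul_right, mink_smul_right,
    e.2, mink_comm e.1 y]
  ring

theorem mink_reflVec_comm (e : Spacelike) (x y : Mink) :
    mink (reflVec e x) y = mink x (reflVec e y) := by
  rw [← mink_reflVec_reflVec e, reflVec_reflVec]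

/-- The reflection in `e^⊥` as a linear automorphism of Minkowski space. -/
def reflLin (e : Spacelike) : Mink ≃ₗ[ℝ] Mink :=
  LinearEquiv.ofInvolutive
    { toFun := reflVec e
      map_add' := fun x y => by simp only [reflVec, mink_add_left]; module
      map_smul' := fun c x => by
        simp only [reflVec, mink_smul_left, RingHom.id_apply]; module }
    (reflVec_reflVec e)

@[simp] theorem reflection_apply (e : Spacelike) (x : H3) : (reflection e x).1 = reflVec e x.1 :=
  rfl

theorem reflection_mul_self (e : Spacelike) : reflection e * reflection e = 1 :=
  Equiv.ext fun x => Subtype.ext (reflVec_reflVec e x.1)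

theorem reflection_inv (e : Spacelike) : (reflection e)⁻¹ = reflection e :=
  inv_eq_of_mul_eq_one_left (reflection_mul_self e)

/-- `L` is a Lorentz transformation inducing the permutation `g` of hyperbolic space. -/
def Induces (L : Mink ≃ₗ[ℝ] Mink) (g : Equiv.Perm H3) : Prop :=
  (∀ u v, mink (L u) (L v) = mink u v) ∧ ∀ x, (g x).1 = L x.1

theorem induces_reflLin (e : Spacelike) : Induces (reflLin e) (reflection e) :=
  ⟨mink_reflVec_reflVec e, fun _ => rfl⟩

theorem Induces.mul {L M : Mink ≃ₗ[ℝ] Mink} {g h : Equiv.Perm H3} (hL : Induces L g)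
    (hM : Induces M h) : Induces (M.trans L) (g * h) :=
  ⟨fun u v => by simp [hL.1, hM.1], fun x => by simp [hL.2, hM.2]⟩

theorem Induces.mink_symm {L : Mink ≃ₗ[ℝ] Mink} {g : Equiv.Perm H3} (hL : Induces L g)
    (u v : Mink) : mink (L.symm u) v = mink u (L v) := by
  rw [← hL.1, L.apply_symm_apply]

theorem Induces.inv {L : Mink ≃ₗ[ℝ] Mink} {g : Equiv.Perm H3} (hL : Induces L g) :
    Induces L.symm g⁻¹ := by
  refine ⟨fun u v => by rw [← hL.1]; simp, fun x => ?_⟩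
  rw [LinearEquiv.eq_symm_apply, ← hL.2, ← Equiv.Perm.mul_apply, mul_inv_cancel, Equiv.Perm.one_apply]

/-- The group of isometries of hyperbolic space. -/
def isometries : Subgroup (Equiv.Perm H3) where
  carrier := {g | ∃ L, Induces L g}
  mul_mem' := fun ⟨_, hL⟩ ⟨_, hM⟩ => ⟨_, hL.mul hM⟩
  one_mem' := ⟨LinearEquiv.refl ℝ Mink, fun _ _ => rfl, fun _ => rfl⟩
  inv_mem' := fun ⟨_, hL⟩ => ⟨_, hL.inv⟩

theorem closure_reflections_le (F : Set Spacelike) :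
    Subgroup.closure (reflection '' F) ≤ isometries := by
  rw [Subgroup.closure_le]
  rintro _ ⟨e, -, rfl⟩
  exact ⟨_, induces_reflLin e⟩

theorem mink_isometry {g : Equiv.Perm H3} (hg : g ∈ isometries) (x y : H3) :
    mink (g x).1 (g y).1 = mink x.1 y.1 := by
  obtain ⟨L, hL⟩ := hg
  rw [hL.2, hL.2, hL.1]

/-- The image of a unit spacelike vector under a Lorentz transformation. -/
def mapSpacelike {L : Mink ≃ₗ[ℝ] Mink} {g : Equiv.Perm H3} (hL : Induces L g) (e : Spacelike) :
    Spacelike := ⟨L e.1, (hL.1 _ _).trans e.2⟩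

theorem reflection_mapSpacelike {L : Mink ≃ₗ[ℝ] Mink} {g : Equiv.Perm H3} (hL : Induces L g)
    (e : Spacelike) : reflection (mapSpacelike hL e) = g * reflection e * g⁻¹ := by
  ext1 x
  apply Subtype.ext
  simp only [Equiv.Perm.mul_apply, hL.2, reflection_apply, reflVec, map_sub, map_smul, hL.inv.2,
    LinearEquiv.apply_symm_apply, mapSpacelike, hL.mink_symm]

/-- The mirror image of a unit spacelike vector. -/
def reflSpacelike (e e' : Spacelike) : Spacelike := mapSpacelike (induces_reflLin e) e'

@[simp] theorem reflSpacelike_val (e e' : Spacelike) : (reflSpacelike e e').1 = reflVec e e'.1 :=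
  rfl

theorem reflection_reflSpacelike (e e' : Spacelike) :
    reflection (reflSpacelike e e') = reflection e * reflection e' * reflection e := by
  rw [reflSpacelike, reflection_mapSpacelike, reflection_inv]

/-! ### Right-angled chambers -/

/-- `P` is the intersection of the half-spaces with outward normals in the finite set `F`, any two
of whose bounding planes are orthogonal or disjoint, and `x₀` lies in the interior of `P`. -/
structure IsChamber (F : Set Spacelike) (P : Set H3) (x₀ : H3) : Prop where
  finite : F.Finite
  mem_iff : ∀ x, x ∈ P ↔ ∀ e ∈ F, mink x.1 e.1 ≤ 0
  pair : ∀ e ∈ F, ∀ e' ∈ F, e ≠ e' → mink e.1 e'.1 = 0 ∨ mink e.1 e'.1 ≤ -1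
  base : ∀ e ∈ F, mink x₀.1 e.1 < 0

/-- All conditions on w are open, so they persist along w + t v for small t > 0, and rescaling
returns to the hyperboloid. The direction v is arbitrary, so this perturbs points both within a wall
and off it. -/
theorem exists_small {F : Set Spacelike} (hF : F.Finite) {w : Mink} (hw : mink w w < 0)
    (hw0 : 0 < w 0) (hwF : ∀ e ∈ F, mink w e.1 < 0) (v : Mink) :
    ∃ (t c : ℝ) (z : H3), 0 < t ∧ 0 < c ∧ z.1 = c • (w + t • v) ∧ ∀ e ∈ F, mink z.1 e.1 < 0 := by
  have hc : Continuous fun t : ℝ => w + t • v := by fun_prop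
  have hz : w + (0 : ℝ) • v = w := by simp
  have h1 : ∀ᶠ t in nhds (0 : ℝ), mink (w + t • v) (w + t • v) < 0 :=
    (continuous_mink hc hc).continuousAt.eventually_lt continuousAt_const (by rwa [hz])
  have h2 : ∀ᶠ t in nhds (0 : ℝ), 0 < (w + t • v) 0 :=
    continuousAt_const.eventually_lt
      ((continuous_apply (0 : Fin 4)).comp hc).continuousAt (by simpa using hw0)
  have h3 : ∀ᶠ t in nhds (0 : ℝ), ∀ e ∈ F, mink (w + t • v) e.1 < 0 :=
    (Filter.eventually_all_finite hF).2 fun e he =>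
      (continuous_mink hc continuous_const).continuousAt.eventually_lt continuousAt_const
        (by simpa [hz] using hwF e he)
  have h4 := (h1.and (h2.and h3)).filter_mono (nhdsWithin_le_nhds (s := Set.Ioi 0))
  obtain ⟨t, ⟨ht1, ht2, ht3⟩, ht⟩ := (h4.and self_mem_nhdsWithin).exists
  obtain ⟨z, c, hc, hzc⟩ := exists_normalize ht1 ht2
  refine ⟨t, c, z, ht, hc, hzc, fun e he => ?_⟩
  rw [hzc, mink_smul_left]
  exact mul_neg_of_pos_of_neg hc (ht3 e he)

/-- If a convex set in the intersection of finitely many half-spaces has points off each of the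
bounding planes, then it has a point off all of them. -/
theorem exists_common_strict {F : Set Spacelike} (hF : F.Finite) {A : Set H3} (hA : A.Nonempty)
    (hconv : ∀ x ∈ A, ∀ y ∈ A, ∀ z : H3, ∀ c : ℝ, 0 < c → z.1 = c • (x.1 + y.1) → z ∈ A)
    (hle : ∀ x ∈ A, ∀ e ∈ F, mink x.1 e.1 ≤ 0) (h : ∀ e ∈ F, ∃ x ∈ A, mink x.1 e.1 < 0) :
    ∃ w ∈ A, ∀ e ∈ F, mink w.1 e.1 < 0 := by
  refine Set.Finite.induction_on_subset
    (motive := fun s _ => ∃ w ∈ A, ∀ e ∈ s, mink w.1 e.1 < 0) F hF ?_ ?_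
  · obtain ⟨w, hw⟩ := hA
    exact ⟨w, hw, by simp⟩
  · rintro e s he hs - ⟨w, hw, hws⟩
    obtain ⟨x, hx, hxe⟩ := h e he
    obtain ⟨z, c, hc, hz⟩ := exists_normalize_add w x zero_le_one
    rw [one_smul] at hz
    refine ⟨z, hconv w hw x hx z c hc hz, ?_⟩
    have key (a : Spacelike) (h : mink w.1 a.1 + mink x.1 a.1 < 0) : mink z.1 a.1 < 0 := by
      rw [hz, mink_smul_left, mink_add_left]
      exact mul_neg_of_pos_of_neg hc h
    rintro a (rfl | ha)
    · exact key _ (by linarith [hle w hw a he])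
    · exact key _ (by linarith [hle x hx a (hs ha), hws a ha])

/-! ### Faces and the planes they span -/

theorem span_face_le (P : Set H3) (e : Spacelike) :
    Submodule.span ℝ ((fun x : H3 => x.1) '' face P e) ≤ LinearMap.ker (minkForm e.1) := by
  rw [Submodule.span_le]
  rintro _ ⟨x, hx, rfl⟩
  exact hx.2

theorem span_face_eq {P : Set H3} {e : Spacelike} (he : e ∈ faceNormals P) :
    Submodule.span ℝ ((fun x : H3 => x.1) '' face P e) = LinearMap.ker (minkForm e.1) :=
  Submodule.eq_of_le_of_finrank_eq (span_face_le P e)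
    (he.2.trans (finrank_ker_minkForm e.ne_zero).symm)

/-- A face determines its plane. -/
theorem eq_or_eq_neg_of_face_subset_wall {P : Set H3} {e e' : Spacelike} (he : e ∈ faceNormals P)
    (h : face P e ⊆ wall e') : e'.1 = e.1 ∨ e'.1 = -e.1 := by
  apply eq_or_eq_neg_of_ker_le
  rw [← span_face_eq he, Submodule.span_le]
  rintro _ ⟨x, hx, rfl⟩
  exact h hx

theorem face_nonempty {P : Set H3} {e : Spacelike} (he : e ∈ faceNormals P) :
    (face P e).Nonempty := by
  by_contra h
  have := he.2
  rw [Set.not_nonempty_iff_eq_empty.1 h, Set.image_empty, Submodule.span_empty, finrank_bot] at this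
  omega

/-- For a face in a polyhedron with an interior point, the only supporting half-space whose plane
contains the face is the one defining it. -/
theorem eq_of_face_subset_wall {P : Set H3} {x₀ : H3} {e e' : Spacelike} (he : e ∈ faceNormals P)
    (h : face P e ⊆ wall e') (hx₀ : x₀ ∈ P) (hx₀' : mink x₀.1 e'.1 < 0) : e' = e := by
  rcases eq_or_eq_neg_of_face_subset_wall he h with h | h
  · exact Subtype.ext h
  · have := he.1 hx₀
    rw [h, mink_neg_right] at hx₀'
    simp only [halfSpace, Set.mem_ofPred_eq] at this
    linarith

theorem face_convex_of_mem_iff {F : Set Spacelike} {P : Set H3} (e : Spacelike)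
    (hP : ∀ x, x ∈ P ↔ ∀ e ∈ F, mink x.1 e.1 ≤ 0) :
    ∀ x ∈ face P e, ∀ y ∈ face P e, ∀ z : H3, ∀ c : ℝ, 0 < c → z.1 = c • (x.1 + y.1) →
      z ∈ face P e := by
  intro x hx y hy z c hc hz
  refine ⟨(hP z).2 fun a ha => ?_, ?_⟩
  · rw [hz, mink_smul_left, mink_add_left]
    have h1 := (hP x).1 hx.1 a ha
    have h2 := (hP y).1 hy.1 a ha
    exact mul_nonpos_of_nonneg_of_nonpos hc.le (by linarith)
  · have h1 : mink x.1 e.1 = 0 := hx.2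
    have h2 : mink y.1 e.1 = 0 := hy.2
    simp [wall, hz, mink_smul_left, mink_add_left, h1, h2]

/-! ### Folding, strict fundamental domains and the faces of a chamber -/

namespace IsChamber

variable {F : Set Spacelike} {P : Set H3} {x₀ : H3}

theorem base_mem (h : IsChamber F P x₀) : x₀ ∈ P := (h.mem_iff _).2 fun e he => (h.base e he).le

theorem pair_nonpos (h : IsChamber F P x₀) {e e' : Spacelike} (he : e ∈ F) (he' : e' ∈ F)
    (hne : e ≠ e') : mink e.1 e'.1 ≤ 0 := by
  rcases h.pair e he e' he' hne with h | h <;> linarith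

/-- Distinct half-spaces not containing a given point have orthogonal bounding planes. -/
theorem orthogonal_of_pos (h : IsChamber F P x₀) {e e' : Spacelike} (he : e ∈ F) (he' : e' ∈ F)
    (hne : e ≠ e') {y : H3} (hy : 0 < mink y.1 e.1) (hy' : 0 < mink y.1 e'.1) :
    mink e.1 e'.1 = 0 := by
  refine (h.pair e he e' he' hne).resolve_right fun hc => ?_
  -- If ⟨e, e'⟩ ≤ -1, then e + e' is causal, as its square is 2 + 2⟨e, e'⟩; pairing with x₀ shows it
  -- is future directed, so it pairs negatively with y.
  have h1 : mink (e.1 + e'.1) (e.1 + e'.1) ≤ 0 := by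
    simp only [mink_add_left, mink_add_right, e.2, e'.2]
    rw [mink_comm e'.1 e.1]
    linarith
  have h2 : mink (e.1 + e'.1) x₀.1 < 0 := by
    rw [mink_add_left, mink_comm e.1, mink_comm e'.1]
    linarith [h.base e he, h.base e' he']
  have h3 := mink_neg_of_timelike_causal (mink_self_H3_neg y) y.2.2 h1 (future_of_mink_neg h1 h2)
  rw [mink_add_right] at h3
  linarith

/-- Folding a point outside a half-space bounded by a plane in `F` into that half-space. -/
def Fold (F : Set Spacelike) (y z : H3) : Prop :=
  ∃ e ∈ F, 0 < mink y.1 e.1 ∧ z = reflection e y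

/-- Different folds available at one point are in orthogonal walls; their reflections commute and
neither changes the other inequality, so one more fold on each side closes the square. This is the
input of the Church–Rosser theorem. -/
theorem fold_diamond (h : IsChamber F P x₀) (a b c : H3) (hab : Fold F a b) (hac : Fold F a c) :
    ∃ d, Relation.ReflGen (Fold F) b d ∧ Relation.ReflTransGen (Fold F) c d := by
  obtain ⟨e, he, hae, rfl⟩ := hab
  obtain ⟨e', he', hae', rfl⟩ := hac
  by_cases hne : e = e'
  · subst hne
    exact ⟨_, .refl, .refl⟩
  have ho := h.orthogonal_of_pos he he' hne hae hae'
  have ho' : mink e'.1 e.1 = 0 := by rw [mink_comm, ho]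
  refine ⟨reflection e' (reflection e a), .single ⟨e', he', ?_, rfl⟩,
    .single ⟨e, he, ?_, Subtype.ext ?_⟩⟩
  · rw [reflection_apply, mink_reflVec_left, ho]; linarith
  · rw [reflection_apply, mink_reflVec_left, ho']; linarith
  · simp only [reflection_apply, reflVec, mink_sub_left, mink_smul_left, ho, ho']
    module

/-- A chamber is a strict fundamental domain of the group generated by the reflections in its
walls. -/
theorem apply_eq_self (h : IsChamber F P x₀) {g : Equiv.Perm H3}
    (hg : g ∈ Subgroup.closure (reflection '' F)) {x : H3} (hx : x ∈ P) (hgx : g x ∈ P) :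
    g x = x := by
  -- Confluence makes joinability an equivalence relation, so relating y to g y reduces to
  -- generators. Termination of folding is not needed.
  have heq := Relation.equivalence_join_reflTransGen h.fold_diamond
  have hj : ∀ y, Relation.Join (Relation.ReflTransGen (Fold F)) y (g y) := by
    clear hgx
    induction hg using Subgroup.closure_induction with
    | mem g hg =>
      obtain ⟨e, he, rfl⟩ := hg
      intro y
      rcases lt_trichotomy (mink y.1 e.1) 0 with hy | hy | hy
      · refine ⟨y, .refl, .single ⟨e, he, ?_, (DFunLike.congr_fun (reflection_mul_self e) y).symm⟩⟩
        rw [reflection_apply, mink_reflVec_left, e.2]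
        linarith
      · have : reflection e y = y := Subtype.ext (by simp [reflVec, hy])
        rw [this]
        exact heq.refl y
      · exact ⟨_, .single ⟨e, he, hy, rfl⟩, .refl⟩
    | one => exact heq.refl
    | mul a b _ _ ha hb => exact fun y => heq.trans (hb y) (ha (b y))
    | inv a _ ha =>
      intro y
      have := heq.symm (ha (a⁻¹ y))
      rwa [← Equiv.Perm.mul_apply, mul_inv_cancel, Equiv.Perm.one_apply] at this
  -- No fold applies inside P, so a common descendant of x and g x equals both.
  have hnf {y z : H3} (hy : y ∈ P) (hyz : Relation.ReflTransGen (Fold F) y z) : z = y := by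
    rcases hyz.cases_head with rfl | ⟨w, ⟨e, he, hye, -⟩, -⟩
    · rfl
    · exact absurd ((h.mem_iff y).1 hy e he) (not_le.2 hye)
  obtain ⟨z, hz, hz'⟩ := hj x
  rw [← hnf hgx hz', hnf hx hz]

/-- The point `x₀` moved orthogonally onto a wall lies on no other wall. -/
theorem exists_face_interior (h : IsChamber F P x₀) {e : Spacelike} (he : e ∈ F) :
    ∃ y : Mink, mink y y < 0 ∧ 0 < y 0 ∧ mink y e.1 = 0 ∧ ∀ a ∈ F \ {e}, mink y a.1 < 0 := by
  have h1 : mink (x₀.1 - mink x₀.1 e.1 • e.1) (x₀.1 - mink x₀.1 e.1 • e.1) < 0 := by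
    simp only [mink_sub_left, mink_sub_right, mink_smul_left, mink_smul_right, e.2, mink_self_H3]
    rw [mink_comm e.1]
    nlinarith [sq_nonneg (mink x₀.1 e.1)]
  refine ⟨x₀.1 - mink x₀.1 e.1 • e.1, h1, future_of_mink_neg (x := x₀) h1.le ?_, ?_,
    fun a ha => ?_⟩
  · rw [mink_sub_left, mink_smul_left, mink_self_H3, mink_comm e.1]
    nlinarith [sq_nonneg (mink x₀.1 e.1)]
  · rw [mink_sub_left, mink_smul_left, e.2]; ring
  · rw [mink_sub_left, mink_smul_left]
    nlinarith [h.base a ha.1, h.base e he, h.pair_nonpos he ha.1 (Ne.symm ha.2)]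

/-- Near the foot of the perpendicular from x₀ to the wall every direction of the plane stays inside
the other half-spaces for a short time, so the face spans the plane. -/
theorem subset_faceNormals (h : IsChamber F P x₀) : F ⊆ faceNormals P := by
  intro e he
  refine ⟨fun x hx => (h.mem_iff x).1 hx e he, ?_⟩
  suffices Submodule.span ℝ ((fun x : H3 => x.1) '' face P e) = LinearMap.ker (minkForm e.1) by
    rw [this, finrank_ker_minkForm e.ne_zero]
  refine le_antisymm (span_face_le P e) fun v hv => ?_
  obtain ⟨y, hy, hy0, hye, hya⟩ := h.exists_face_interior he
  have key (u : Mink) (hu : mink u e.1 = 0) :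
      ∃ t : ℝ, 0 < t ∧ y + t • u ∈ Submodule.span ℝ ((fun x : H3 => x.1) '' face P e) := by
    obtain ⟨t, c, z, ht, hc, hz, hzF⟩ := exists_small (h.finite.subset Set.sdiff_subset) hy hy0 hya u
    have hze : mink z.1 e.1 = 0 := by
      rw [hz, mink_smul_left, mink_add_left, mink_smul_left, hu, hye]; ring
    have hzP : z ∈ face P e := by
      refine ⟨(h.mem_iff z).2 fun a ha => ?_, hze⟩
      by_cases hae : a = e
      · rw [hae, hze]
      · exact (hzF a ⟨ha, hae⟩).le
    refine ⟨t, ht, ?_⟩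
    have : y + t • u = c⁻¹ • z.1 := by rw [hz, smul_smul, inv_mul_cancel₀ hc.ne', one_smul]
    rw [this]
    exact Submodule.smul_mem _ _ (Submodule.subset_span ⟨z, hzP, rfl⟩)
  obtain ⟨t, ht, h1⟩ := key v hv
  -- The zero direction puts y itself in the span, and v is recovered from a difference.
  obtain ⟨s, hs, h2⟩ := key 0 (by simp [mink])
  rw [smul_zero, add_zero] at h2
  have h3 : v = t⁻¹ • ((y + t • v) - y) := by
    rw [add_sub_cancel_left, smul_smul, inv_mul_cancel₀ ht.ne', one_smul]
  rw [h3]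
  exact Submodule.smul_mem _ _ (Submodule.sub_mem _ h1 h2)

/-- A face with normal outside F would contain a point off every wall in F; such a point can be
pushed outward across the face without leaving P. -/
theorem faceNormals_eq (h : IsChamber F P x₀) : faceNormals P = F := by
  refine Set.Subset.antisymm (fun e he => ?_) h.subset_faceNormals
  by_contra heF
  obtain ⟨w, hw, hwF⟩ := exists_common_strict h.finite (A := face P e)
    (face_nonempty he) (face_convex_of_mem_iff e h.mem_iff)
    (fun x hx a ha => (h.mem_iff x).1 hx.1 a ha) (by
      intro a ha
      by_contra hcon
      push Not at hcon
      have := eq_of_face_subset_wall he (e' := a)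
        (fun x hx => le_antisymm ((h.mem_iff x).1 hx.1 a ha) (hcon x hx)) h.base_mem (h.base a ha)
      exact heF (this ▸ ha))
  obtain ⟨t, c, z, ht, hc, hz, hzF⟩ :=
    exists_small h.finite (mink_self_H3_neg w) w.2.2 hwF e.1
  have h1 : mink z.1 e.1 ≤ 0 := he.1 ((h.mem_iff z).2 fun a ha => (hzF a ha).le)
  have h2 : mink w.1 e.1 = 0 := hw.2
  rw [hz, mink_smul_left, mink_add_left, mink_smul_left, h2, e.2] at h1
  have := mul_pos hc ht
  linarith

end IsChamber

/-! ### Reflecting a chamber across a wall -/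

/-- The outward normals of the union of a chamber and its mirror image in the wall `e`. -/
def doubleNormals (F : Set Spacelike) (e : Spacelike) : Set Spacelike :=
  (F \ {e}) ∪ reflSpacelike e '' (F \ {e})

/-- The products with a mirror image are ⟨a, r_e b⟩ = ⟨a, b⟩ - 2⟨a, e⟩⟨b, e⟩, and all products of
distinct normals are nonpositive, so reflecting only pushes them down. On its own side of e, each
half of the double is cut out by its own walls, and the other half imposes nothing new. -/
theorem IsChamber.double {F : Set Spacelike} {P : Set H3} {x₀ : H3} (h : IsChamber F P x₀)
    {e : Spacelike} (he : e ∈ F) :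
    IsChamber (doubleNormals F e) (P ∪ reflection e '' P) x₀ := by
  have hneg {a : Spacelike} (ha : a ∈ F \ {e}) : mink a.1 e.1 ≤ 0 :=
    h.pair_nonpos ha.1 he ha.2
  have hrefl (x a : Mink) :
      mink x (reflVec e a) = mink x a - 2 * mink x e.1 * mink a e.1 := by
    rw [← mink_reflVec_comm, mink_reflVec_left, mink_comm e.1]
  have hmix {a b : Spacelike} (ha : a ∈ F \ {e}) (hb : b ∈ F \ {e}) (hne : a ≠ reflSpacelike e b) :
      mink a.1 (reflSpacelike e b).1 = 0 ∨ mink a.1 (reflSpacelike e b).1 ≤ -1 := by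
    rw [reflSpacelike_val, hrefl]
    by_cases hab : a = b
    · subst hab
      rw [a.2]
      -- A wall orthogonal to e equals its mirror image; otherwise the product is 1 - 2⟨a, e⟩² ≤ -1.
      rcases h.pair a ha.1 e he ha.2 with h0 | h0
      · exact absurd (Subtype.ext (by simp [reflVec, h0])) hne
      · right; nlinarith
    · rcases h.pair a ha.1 e he ha.2 with h1 | h1
      · simpa [h1] using h.pair a ha.1 b hb.1 hab
      · rcases h.pair b hb.1 e he hb.2 with h2 | h2
        · simpa [h2] using h.pair a ha.1 b hb.1 hab
        · right
          have := h.pair_nonpos ha.1 hb.1 hab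
          nlinarith
  have hmem (x : H3) (hx : mink x.1 e.1 ≤ 0) :
      x ∈ P ↔ ∀ a ∈ F \ {e}, mink x.1 a.1 ≤ 0 := by
    rw [h.mem_iff]
    refine ⟨fun hx a ha => hx a ha.1, fun hx' a ha => ?_⟩
    by_cases hae : a = e
    · rwa [hae]
    · exact hx' a ⟨ha, hae⟩
  have hPD (x : H3) (hx : x ∈ P) : ∀ a ∈ F \ {e}, mink x.1 (reflSpacelike e a).1 ≤ 0 := by
    intro a ha
    rw [reflSpacelike_val, hrefl]
    have h1 := (h.mem_iff x).1 hx a ha.1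
    have h2 := (h.mem_iff x).1 hx e he
    nlinarith [hneg ha]
  refine ⟨?_, fun x => ⟨?_, fun hx => ?_⟩, ?_, ?_⟩
  · have := h.finite.subset (Set.sdiff_subset (t := {e}))
    exact this.union (this.image _)
  · rintro (hx | ⟨y, hy, rfl⟩)
    · rintro _ (ha | ⟨a, ha, rfl⟩)
      · exact (h.mem_iff x).1 hx _ ha.1
      · exact hPD x hx a ha
    · rintro b (hb | ⟨a, ha, rfl⟩)
      · rw [reflection_apply, mink_reflVec_comm]
        exact hPD y hy b hb
      · rw [reflection_apply, reflSpacelike_val, mink_reflVec_reflVec]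
        exact (h.mem_iff y).1 hy a ha.1
  · rcases le_total (mink x.1 e.1) 0 with hxe | hxe
    · exact Or.inl ((hmem x hxe).2 fun a ha => hx a (Or.inl ha))
    · refine Or.inr ⟨reflection e x, (hmem _ ?_).2 fun a ha => ?_,
        DFunLike.congr_fun (reflection_mul_self e) x⟩
      · rw [reflection_apply, mink_reflVec_left, e.2]; linarith
      · rw [reflection_apply, mink_reflVec_comm]
        exact hx _ (Or.inr ⟨a, ha, rfl⟩)
  · rintro a (ha | ⟨a, ha, rfl⟩) b (hb | ⟨b, hb, rfl⟩) hne
    · exact h.pair a ha.1 b hb.1 hne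
    · exact hmix ha hb hne
    · rw [mink_comm]
      exact hmix hb ha hne.symm
    · rw [reflSpacelike_val, reflSpacelike_val, mink_reflVec_reflVec]
      exact h.pair a ha.1 b hb.1 fun hab => hne (by rw [hab])
  · rintro _ (ha | ⟨a, ha, rfl⟩)
    · exact h.base _ ha.1
    · rw [reflSpacelike_val, hrefl]
      nlinarith [hneg ha, h.base a ha.1, h.base e he]

theorem closure_doubleNormals_le {F : Set Spacelike} {e : Spacelike} (he : e ∈ F) :
    Subgroup.closure (reflection '' doubleNormals F e) ≤ Subgroup.closure (reflection '' F) := by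
  rw [Subgroup.closure_le]
  have hF {a : Spacelike} (ha : a ∈ F) : reflection a ∈ Subgroup.closure (reflection '' F) :=
    Subgroup.subset_closure ⟨a, ha, rfl⟩
  rintro _ ⟨b, hb | ⟨a, ha, rfl⟩, rfl⟩
  · exact hF hb.1
  · rw [reflection_reflSpacelike]
    exact mul_mem (mul_mem (hF he) (hF ha.1)) (hF he)

/-- Reflecting a chamber across a wall passes to a subgroup of index at most two. -/
theorem relIndex_doubleNormals_ne_zero {F : Set Spacelike} {e : Spacelike} (he : e ∈ F) :
    (Subgroup.closure (reflection '' doubleNormals F e)).relIndex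
      (Subgroup.closure (reflection '' F)) ≠ 0 := by
  set H := Subgroup.closure (reflection '' doubleNormals F e) with hH
  set G := Subgroup.closure (reflection '' F) with hG
  -- With s the reflection in e, the claim is that H and sH cover G. Left multiplication by s swaps
  -- the two cases; for another generator r, use (s r s)(s g) = s (r g).
  have hstep (a : Spacelike) (ha : a ∈ F) (g : Equiv.Perm H3) (ih : g ∈ H ∨ reflection e * g ∈ H) :
      reflection a * g ∈ H ∨ reflection e * (reflection a * g) ∈ H := by
    by_cases hae : a = e
    · subst hae
      rw [← mul_assoc, reflection_mul_self, one_mul]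
      exact ih.symm
    · have h1 : reflection a ∈ H := Subgroup.subset_closure ⟨a, Or.inl ⟨ha, hae⟩, rfl⟩
      have h2 : reflection (reflSpacelike e a) ∈ H :=
        Subgroup.subset_closure ⟨_, Or.inr ⟨a, ⟨ha, hae⟩, rfl⟩, rfl⟩
      refine ih.imp (fun h => mul_mem h1 h) fun h => ?_
      have := mul_mem h2 h
      rwa [reflection_reflSpacelike, mul_assoc, ← mul_assoc (reflection e) (reflection e),
        reflection_mul_self, one_mul, mul_assoc] at this
  have hcover : ∀ g ∈ G, g ∈ H ∨ reflection e * g ∈ H := by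
    intro g hg
    induction hg using Subgroup.closure_induction_left with
    | one => exact Or.inl (one_mem H)
    | mul_left y hy g _ ih =>
      obtain ⟨a, ha, rfl⟩ := hy
      exact hstep a ha g ih
    | inv_mul_cancel y hy g _ ih =>
      obtain ⟨a, ha, rfl⟩ := hy
      rw [reflection_inv]
      exact hstep a ha g ih
  have hs : reflection e ∈ G := Subgroup.subset_closure ⟨e, he, rfl⟩
  let f : Bool → G ⧸ H.subgroupOf G := fun b => if b then QuotientGroup.mk 1
    else QuotientGroup.mk ⟨reflection e, hs⟩
  have hf : Function.Surjective f := by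
    intro q
    obtain ⟨g, rfl⟩ := QuotientGroup.mk_surjective q
    rcases hcover g.1 g.2 with h | h
    · exact ⟨true, QuotientGroup.eq.2 (by simpa [Subgroup.mem_subgroupOf] using h)⟩
    · exact ⟨false, QuotientGroup.eq.2
        (by simpa [Subgroup.mem_subgroupOf, reflection_inv] using h)⟩
  have : Finite (G ⧸ H.subgroupOf G) := Finite.of_surjective f hf
  exact (Subgroup.finiteIndex_of_finite_quotient (H := H.subgroupOf G)).index_ne_zero

/-- The limit t → 0, used to carry inequalities from interior points of a chamber to its boundary.
-/
theorem nonpos_of_forall_add_mul_neg {a b : ℝ} (h : ∀ t : ℝ, 0 < t → a + t * b < 0) : a ≤ 0 := by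
  by_contra ha
  push Not at ha
  have hb : 0 < |b| + 1 := by positivity
  have h1 := h (a / (|b| + 1)) (by positivity)
  have h2 : a / (|b| + 1) * b ≥ -(a / (|b| + 1) * |b|) := by
    have := mul_le_mul_of_nonneg_left (neg_abs_le b) (div_pos ha hb).le
    linarith
  have h3 : a / (|b| + 1) * |b| + a / (|b| + 1) = a := by field_simp
  have h4 : 0 < a / (|b| + 1) := by positivity
  linarith

/-! ### Mirrors of the reflection group and walls shared by nested polyhedra -/

namespace IsChamber

variable {F : Set Spacelike} {P : Set H3} {x₀ : H3}

/-- Only the identity of the reflection group maps the base point into the chamber. -/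
theorem eq_one_of_apply_mem (h : IsChamber F P x₀) {g : Equiv.Perm H3}
    (hg : g ∈ Subgroup.closure (reflection '' F)) (hgx : g x₀ ∈ P) : g = 1 := by
  have hfix := h.apply_eq_self hg h.base_mem hgx
  obtain ⟨L, hL⟩ := closure_reflections_le F hg
  have hLx : L x₀.1 = x₀.1 := by rw [← hL.2, hfix]
  ext1 y
  apply Subtype.ext
  -- Testing against F and its image under L⁻¹ keeps both z and g z in P, so g fixes z. Since L
  -- fixes x₀ and z is proportional to x₀ + t y, it also fixes y.
  obtain ⟨t, c, z, ht, hc, hz, hzF⟩ := exists_small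
    (h.finite.union (h.finite.image (mapSpacelike hL.inv))) (mink_self_H3_neg x₀) x₀.2.2 (by
      rintro _ (ha | ⟨a, ha, rfl⟩)
      · exact h.base _ ha
      · change mink x₀.1 (L.symm a.1) < 0
        rw [mink_comm, hL.mink_symm, hLx, mink_comm]
        exact h.base a ha) y.1
  have hzP : z ∈ P := (h.mem_iff z).2 fun e he => (hzF e (Or.inl he)).le
  have hgzP : g z ∈ P := (h.mem_iff _).2 fun e he => by
    have : mink z.1 (L.symm e.1) < 0 := hzF _ (Or.inr ⟨e, he, rfl⟩)
    rw [mink_comm, hL.mink_symm, mink_comm, ← hL.2] at this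
    exact this.le
  have h1 := congrArg Subtype.val (h.apply_eq_self hg hzP hgzP)
  rw [hL.2, hz, map_smul, map_add, map_smul, hLx] at h1
  have h2 := smul_right_injective _ ht.ne' (add_left_cancel (smul_right_injective _ hc.ne' h1))
  rw [hL.2, Equiv.Perm.one_apply]
  exact h2

/-- The mirrors of the reflection group miss the interior of the chamber. -/
theorem mink_ne_zero_of_mirror (h : IsChamber F P x₀) {ρ : Spacelike}
    (hρ : reflection ρ ∈ Subgroup.closure (reflection '' F)) {q : H3}
    (hq : ∀ e ∈ F, mink q.1 e.1 < 0) : mink q.1 ρ.1 ≠ 0 := by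
  intro h0
  have hfix : reflVec ρ q.1 = q.1 := by simp [reflVec, h0]
  -- Moving q off the mirror along ρ, both z and its mirror image stay in P for small t; they would
  -- have to coincide, but z is not on the mirror.
  obtain ⟨t, c, z, ht, hc, hz, hzF⟩ := exists_small
    (h.finite.union (h.finite.image (reflSpacelike ρ))) (mink_self_H3_neg q) q.2.2 (by
      rintro _ (ha | ⟨a, ha, rfl⟩)
      · exact hq _ ha
      · rw [reflSpacelike_val, ← mink_reflVec_comm, hfix]
        exact hq a ha) ρ.1
  have hzP : z ∈ P := (h.mem_iff z).2 fun e he => (hzF e (Or.inl he)).le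
  have hgzP : reflection ρ z ∈ P := (h.mem_iff _).2 fun e he => by
    rw [reflection_apply, mink_reflVec_comm]
    exact (hzF _ (Or.inr ⟨e, he, rfl⟩)).le
  have h1 := congrArg (fun x : H3 => mink x.1 ρ.1) (h.apply_eq_self hρ hzP hgzP)
  have h2 : mink z.1 ρ.1 = c * t := by
    rw [hz, mink_smul_left, mink_add_left, mink_smul_left, h0, ρ.2]; ring
  simp only [reflection_apply, mink_reflVec_left, ρ.2, h2] at h1
  have := mul_pos hc ht
  linarith

/-- A mirror separating q from q' would cross the segment between them, all of whose points are
interior to the chamber. -/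
theorem mink_neg_of_mirror (h : IsChamber F P x₀) {ρ : Spacelike}
    (hρ : reflection ρ ∈ Subgroup.closure (reflection '' F)) {q q' : H3}
    (hq : ∀ e ∈ F, mink q.1 e.1 < 0) (hq' : ∀ e ∈ F, mink q'.1 e.1 < 0)
    (hneg : mink q.1 ρ.1 < 0) : mink q'.1 ρ.1 < 0 := by
  by_contra hcon
  have hpos : 0 < mink q'.1 ρ.1 :=
    lt_of_le_of_ne (not_lt.1 hcon) (h.mink_ne_zero_of_mirror hρ hq').symm
  have ht : 0 ≤ -mink q.1 ρ.1 / mink q'.1 ρ.1 := div_nonneg (by linarith) hpos.le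
  obtain ⟨z, c, hc, hz⟩ := exists_normalize_add q q' ht
  refine h.mink_ne_zero_of_mirror hρ (q := z) (fun e he => ?_) ?_
  · rw [hz, mink_smul_left, mink_add_left, mink_smul_left]
    exact mul_neg_of_pos_of_neg hc (by nlinarith [hq e he, hq' e he])
  · rw [hz, mink_smul_left, mink_add_left, mink_smul_left, div_mul_cancel₀ _ hpos.ne']
    ring

/-- The only mirror separating the base point from its image under the reflection in a wall is
that wall. -/
theorem eq_of_mirror_separates (h : IsChamber F P x₀) {ρ e : Spacelike}
    (hρ : reflection ρ ∈ Subgroup.closure (reflection '' F)) (he : e ∈ F)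
    (h1 : mink x₀.1 ρ.1 ≤ 0) (h2 : 0 < mink (reflection e x₀).1 ρ.1) : ρ = e := by
  have hx₀ρ : mink x₀.1 ρ.1 < 0 :=
    lt_of_le_of_ne h1 (h.mink_ne_zero_of_mirror hρ h.base)
  -- It suffices that the face on e lies in the mirror. Interior points near p are on the negative
  -- side of ρ and on the positive side of r_e ρ, while p pairs equally with both because it lies on
  -- e.
  refine eq_of_face_subset_wall (h.subset_faceNormals he) (fun p hp => ?_) h.base_mem hx₀ρ
  have hz (t : ℝ) (ht : 0 < t) : ∃ (z : H3) (c : ℝ), 0 < c ∧ z.1 = c • (p.1 + t • x₀.1) ∧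
      ∀ a ∈ F, mink z.1 a.1 < 0 := by
    obtain ⟨z, c, hc, hz⟩ := exists_normalize_add p x₀ ht.le
    refine ⟨z, c, hc, hz, fun a ha => ?_⟩
    rw [hz, mink_smul_left, mink_add_left, mink_smul_left]
    exact mul_neg_of_pos_of_neg hc (by nlinarith [h.base a ha, (h.mem_iff p).1 hp.1 a ha])
  have hρ' : reflection (reflSpacelike e ρ) ∈ Subgroup.closure (reflection '' F) := by
    have he' : reflection e ∈ Subgroup.closure (reflection '' F) :=
      Subgroup.subset_closure ⟨e, he, rfl⟩
    rw [reflection_reflSpacelike]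
    exact mul_mem (mul_mem he' hρ) he'
  have hpe : mink p.1 e.1 = 0 := hp.2
  have hpr : mink p.1 (reflSpacelike e ρ).1 = mink p.1 ρ.1 := by
    rw [reflSpacelike_val, ← mink_reflVec_comm, mink_reflVec_left, hpe]; ring
  rw [reflection_apply, mink_reflVec_comm] at h2
  apply le_antisymm
  · refine nonpos_of_forall_add_mul_neg (b := mink x₀.1 ρ.1) fun t ht => ?_
    obtain ⟨z, c, hc, hzc, hzF⟩ := hz t ht
    have := h.mink_neg_of_mirror hρ h.base hzF hx₀ρ
    rw [hzc, mink_smul_left, mink_add_left, mink_smul_left] at this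
    exact neg_of_mul_neg_right this hc.le
  · rw [← hpr]
    refine neg_nonpos.1 (nonpos_of_forall_add_mul_neg (b := -mink x₀.1 (reflSpacelike e ρ).1)
      fun t ht => ?_)
    obtain ⟨z, c, hc, hzc, hzF⟩ := hz t ht
    have hne := h.mink_ne_zero_of_mirror hρ' hzF
    have : 0 < mink z.1 (reflSpacelike e ρ).1 := by
      by_contra hcon
      have := h.mink_neg_of_mirror hρ' hzF h.base (lt_of_le_of_ne (not_lt.1 hcon) hne)
      rw [reflSpacelike_val] at this
      linarith
    rw [hzc, mink_smul_left, mink_add_left, mink_smul_left] at this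
    have := pos_of_mul_pos_right this hc.le
    linarith

/-- Let `Q ⊆ Q'` be intersections of half-spaces bounded by mirrors. If a translate of the
base point lies in `Q` and its neighbour does not lie in `Q'`, then `Q` and `Q'` share a
bounding plane. -/
theorem exists_common_wall (h : IsChamber F P x₀) {Q Q' : Set H3} {E E' : Set Spacelike}
    (hQ : ∀ x, x ∈ Q ↔ ∀ e ∈ E, mink x.1 e.1 ≤ 0) (hQ' : ∀ x, x ∈ Q' ↔ ∀ e ∈ E', mink x.1 e.1 ≤ 0)
    (hE : ∀ e ∈ E, reflection e ∈ Subgroup.closure (reflection '' F))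
    (hE' : ∀ e ∈ E', reflection e ∈ Subgroup.closure (reflection '' F)) (hsub : Q ⊆ Q')
    {g : Equiv.Perm H3} (hg : g ∈ Subgroup.closure (reflection '' F)) {e : Spacelike} (he : e ∈ F)
    (hgx : g x₀ ∈ Q) (hgex : g (reflection e x₀) ∉ Q') : ∃ ρ, ρ ∈ E ∧ ρ ∈ E' := by
  obtain ⟨L, hL⟩ := closure_reflections_le F hg
  have key (a : Spacelike) (ha : reflection a ∈ Subgroup.closure (reflection '' F))
      (h1 : mink (g x₀).1 a.1 ≤ 0) (h2 : 0 < mink (g (reflection e x₀)).1 a.1) :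
      a = mapSpacelike hL e := by
    have h3 : mapSpacelike hL.inv a = e := by
      refine h.eq_of_mirror_separates ?_ he ?_ ?_
      · rw [reflection_mapSpacelike]
        exact mul_mem (mul_mem (inv_mem hg) ha) (inv_mem (inv_mem hg))
      · change mink x₀.1 (L.symm a.1) ≤ 0
        rwa [mink_comm, hL.mink_symm, mink_comm, ← hL.2]
      · change 0 < mink _ (L.symm a.1)
        rwa [mink_comm, hL.mink_symm, mink_comm, ← hL.2]
    rw [← h3]
    exact Subtype.ext (L.apply_symm_apply a.1).symm
  -- The neighbour violates a half-space of Q and one of Q'. Both separate it from g x₀, so by `key`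
  -- both have normal L e.
  have hgex' : g (reflection e x₀) ∉ Q := fun hh => hgex (hsub hh)
  rw [hQ] at hgex'
  rw [hQ'] at hgex
  push Not at hgex hgex'
  obtain ⟨a, ha, ha'⟩ := hgex'
  obtain ⟨b, hb, hb'⟩ := hgex
  refine ⟨mapSpacelike hL e, ?_, ?_⟩
  · rw [← key a (hE a ha) ((hQ _).1 hgx a ha) ha']
    exact ha
  · rw [← key b (hE' b hb) ((hQ' _).1 (hsub hgx) b hb) hb']
    exact hb

end IsChamber

/-! ### The sequence of polyhedra -/

namespace Construction

variable (C : Construction) {x₀ : H3}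

/-- Doubling keeps the base point, and the normals of a chamber are recovered as its face normals,
so the same statement passes to the next polyhedron. -/
theorem chamber (h : IsChamber (faceNormals (C.poly 0)) (C.poly 0) x₀) (m : ℕ) :
    IsChamber (faceNormals (C.poly m)) (C.poly m) x₀ := by
  induction m with
  | zero => exact h
  | succ m ih =>
    have := ih.double (C.mirror_mem m)
    rw [← C.poly_succ] at this
    rwa [this.faceNormals_eq]

theorem faceNormals_succ (h : IsChamber (faceNormals (C.poly 0)) (C.poly 0) x₀) (m : ℕ) :
    faceNormals (C.poly (m + 1)) = doubleNormals (faceNormals (C.poly m)) (C.mirror m) := by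
  have := (C.chamber h m).double (C.mirror_mem m)
  rw [← C.poly_succ] at this
  exact this.faceNormals_eq

theorem poly_mono : Monotone C.poly :=
  monotone_nat_of_le_succ fun m => by rw [C.poly_succ]; exact Set.subset_union_left

theorem reflectionGroup_antitone (h : IsChamber (faceNormals (C.poly 0)) (C.poly 0) x₀) :
    Antitone fun m => reflectionGroup (C.poly m) :=
  antitone_nat_of_succ_le fun m => by
    rw [reflectionGroup, C.faceNormals_succ h]
    exact closure_doubleNormals_le (C.mirror_mem m)

theorem relIndex_ne_zero (h : IsChamber (faceNormals (C.poly 0)) (C.poly 0) x₀) (m : ℕ) :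
    (reflectionGroup (C.poly m)).relIndex (reflectionGroup (C.poly 0)) ≠ 0 := by
  induction m with
  | zero => simp
  | succ m ih =>
    refine Subgroup.relIndex_ne_zero_trans ?_ ih
    rw [reflectionGroup, C.faceNormals_succ h]
    exact relIndex_doubleNormals_ne_zero (C.mirror_mem m)

theorem mirror_mem_reflectionGroup (h : IsChamber (faceNormals (C.poly 0)) (C.poly 0) x₀) {m : ℕ}
    {e : Spacelike} (he : e ∈ faceNormals (C.poly m)) :
    reflection e ∈ reflectionGroup (C.poly 0) :=
  C.reflectionGroup_antitone h m.zero_le (Subgroup.subset_closure ⟨e, he, rfl⟩)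

theorem stageStart_mono : Monotone (stageStart C.k) :=
  monotone_nat_of_le_succ fun i => by simp [stageStart, Finset.sum_range_succ]

/-- Each stage absorbs all chambers adjacent to chambers of the previous one. -/
theorem apply_reflection_mem (h : IsChamber (faceNormals (C.poly 0)) (C.poly 0) x₀) {i : ℕ}
    {g : Equiv.Perm H3} (hg : g ∈ reflectionGroup (C.poly 0))
    (hgx : g x₀ ∈ C.poly (stageStart C.k i)) {e : Spacelike} (he : e ∈ faceNormals (C.poly 0)) :
    g (reflection e x₀) ∈ C.poly (stageStart C.k (i + 1)) := by
  by_contra hcon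
  have hsub := C.poly_mono (C.stageStart_mono i.le_succ)
  obtain ⟨ρ, hρ, hρ'⟩ := h.exists_common_wall (C.chamber h _).mem_iff (C.chamber h _).mem_iff
    (fun _ => C.mirror_mem_reflectionGroup h) (fun _ => C.mirror_mem_reflectionGroup h)
    hsub hg he hgx hcon
  -- With a common normal, the face of the smaller polyhedron is contained in that of the larger
  -- one.
  exact C.absorbed i ρ hρ' ⟨ρ, hρ, Set.inter_subset_inter_left _ hsub⟩

/-- Induction on words read from the left: g r_e x₀ is a neighbour of g x₀, so each new letter on
the right costs at most one stage. -/
theorem exists_apply_base_mem (h : IsChamber (faceNormals (C.poly 0)) (C.poly 0) x₀)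
    {g : Equiv.Perm H3} (hg : g ∈ reflectionGroup (C.poly 0)) :
    ∃ i, g x₀ ∈ C.poly (stageStart C.k i) := by
  rw [reflectionGroup] at hg
  induction hg using Subgroup.closure_induction_right with
  | one => exact ⟨0, h.base_mem⟩
  | mul_right g hg y hy ih =>
    obtain ⟨e, he, rfl⟩ := hy
    obtain ⟨i, hi⟩ := ih
    exact ⟨i + 1, C.apply_reflection_mem h hg hi he⟩
  | mul_inv_cancel g hg y hy ih =>
    obtain ⟨e, he, rfl⟩ := hy
    obtain ⟨i, hi⟩ := ih
    rw [reflection_inv]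
    exact ⟨i + 1, C.apply_reflection_mem h hg hi he⟩

theorem iInf_G_eq_bot (h : IsChamber (faceNormals (C.poly 0)) (C.poly 0) x₀) :
    (⨅ p : C.Idx, C.G p) = ⊥ := by
  refine (Subgroup.eq_bot_iff_forall _).2 fun g hg => ?_
  rw [Subgroup.mem_iInf] at hg
  obtain ⟨i, hi⟩ := C.exists_apply_base_mem h (g := g) (hg ⟨0, 0⟩)
  exact (C.chamber h _).eq_one_of_apply_mem (hg ⟨i, 0⟩) hi

end Construction

/-! ### Faces of ideal polyhedra -/

/-- The nonnegative combinations of a finite set of vectors. -/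
def nonnegSpan (S : Finset Mink) : Set Mink :=
  {y | ∃ c : Mink → ℝ, (∀ v ∈ S, 0 ≤ c v) ∧ y = ∑ v ∈ S, c v • v}

theorem add_mem_nonnegSpan {S : Finset Mink} {x y : Mink} (hx : x ∈ nonnegSpan S)
    (hy : y ∈ nonnegSpan S) : x + y ∈ nonnegSpan S := by
  obtain ⟨a, ha, rfl⟩ := hx
  obtain ⟨b, hb, rfl⟩ := hy
  exact ⟨a + b, fun v hv => add_nonneg (ha v hv) (hb v hv), by
    simp [add_smul, Finset.sum_add_distrib]⟩

theorem smul_mem_nonnegSpan {S : Finset Mink} {x : Mink} (hx : x ∈ nonnegSpan S) {t : ℝ}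
    (ht : 0 ≤ t) : t • x ∈ nonnegSpan S := by
  obtain ⟨a, ha, rfl⟩ := hx
  exact ⟨t • a, fun v hv => mul_nonneg ht (ha v hv), by
    simp [Finset.smul_sum, smul_smul]⟩

theorem mem_nonnegSpan {S : Finset Mink} {v : Mink} (hv : v ∈ S) : v ∈ nonnegSpan S := by
  classical
  refine ⟨Pi.single v 1, fun w _ => ?_, ?_⟩
  · by_cases h : w = v
    · subst h; simp
    · simp [h]
  · rw [Finset.sum_eq_single v]
    · simp
    · intro w _ h; simp [h]
    · exact fun h => absurd hv h

theorem convex_nonnegSpan (S : Finset Mink) : Convex ℝ (nonnegSpan S) :=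
  fun _ hx _ hy _ _ ha hb _ =>
    add_mem_nonnegSpan (smul_mem_nonnegSpan hx ha) (smul_mem_nonnegSpan hy hb)

theorem map_nonpos_of_mem_nonnegSpan {S : Finset Mink} {f : Mink →ₗ[ℝ] ℝ} (hf : ∀ v ∈ S, f v ≤ 0)
    {x : Mink} (hx : x ∈ nonnegSpan S) : f x ≤ 0 := by
  obtain ⟨c, hc, rfl⟩ := hx
  rw [map_sum]
  refine Finset.sum_nonpos fun v hv => ?_
  rw [map_smul, smul_eq_mul]
  exact mul_nonpos_of_nonneg_of_nonpos (hc v hv) (hf v hv)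

/-- Farkas' lemma for a cone spanned by finitely many vectors in an open half-space. -/
theorem exists_separating_form {S : Finset Mink} (hS : ∀ v ∈ S, 0 < v 0) {x : Mink} (hx0 : 0 < x 0)
    (hx : x ∉ nonnegSpan S) : ∃ f : Mink →ₗ[ℝ] ℝ, (∀ v ∈ S, f v ≤ 0) ∧ 0 < f x := by
  classical
  -- Scaling generators to time coordinate 1 gives a compact polytope, to which Hahn–Banach applies;
  -- subtracting u times the time coordinate turns the affine separation into a linear one.
  set S' : Set Mink := (fun v : Mink => (v 0)⁻¹ • v) '' (S : Set Mink) with hS'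
  have hfin : S'.Finite := S.finite_toSet.image _
  have hnot : (x 0)⁻¹ • x ∉ convexHull ℝ S' := by
    intro h
    have h1 : convexHull ℝ S' ⊆ nonnegSpan S := by
      refine convexHull_min ?_ (convex_nonnegSpan S)
      rintro _ ⟨v, hv, rfl⟩
      exact smul_mem_nonnegSpan (mem_nonnegSpan hv) (inv_pos.2 (hS v hv)).le
    have h2 := smul_mem_nonnegSpan (h1 h) hx0.le
    rw [smul_smul, mul_inv_cancel₀ hx0.ne', one_smul] at h2
    exact hx h2
  obtain ⟨f, u, hfu, hux⟩ := geometric_hahn_banach_closed_point (convex_convexHull ℝ S')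
    (hfin.isCompact_convexHull ℝ).isClosed hnot
  refine ⟨(f : Mink →ₗ[ℝ] ℝ) - u • LinearMap.proj 0, fun v hv => ?_, ?_⟩
  · have h1 := hfu _ (subset_convexHull ℝ S' ⟨v, hv, rfl⟩)
    rw [map_smul, smul_eq_mul, inv_mul_lt_iff₀ (hS v hv)] at h1
    simp only [LinearMap.sub_apply, LinearMap.smul_apply, LinearMap.proj_apply, smul_eq_mul,
      ContinuousLinearMap.coe_coe]
    linarith
  · rw [map_smul, smul_eq_mul, lt_inv_mul_iff₀ hx0] at hux
    simp only [LinearMap.sub_apply, LinearMap.smul_apply, LinearMap.proj_apply, smul_eq_mul,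
      ContinuousLinearMap.coe_coe]
    linarith

/-- A vector separated from a full-dimensional finitely generated cone is separated from it by a
facet. -/
theorem exists_facet_form {S : Finset Mink} (hS : Submodule.span ℝ (S : Set Mink) = ⊤) {x : Mink}
    (h : ∃ f : Mink →ₗ[ℝ] ℝ, (∀ v ∈ S, f v ≤ 0) ∧ 0 < f x) :
    ∃ f : Mink →ₗ[ℝ] ℝ, (∀ v ∈ S, f v ≤ 0) ∧ 0 < f x ∧
      Submodule.span ℝ {v | v ∈ S ∧ f v = 0} = LinearMap.ker f := by
  classical
  -- Among the separating forms, take one that vanishes on as many generators as possible.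
  obtain ⟨f, ⟨hf, hfx⟩, hmin⟩ := WellFounded.has_min
    (measure fun f : Mink →ₗ[ℝ] ℝ => (S.filter fun v => f v ≠ 0).card).wf
    {f : Mink →ₗ[ℝ] ℝ | (∀ v ∈ S, f v ≤ 0) ∧ 0 < f x} h
  have hle : Submodule.span ℝ {v | v ∈ S ∧ f v = 0} ≤ LinearMap.ker f := by
    rw [Submodule.span_le]
    exact fun v hv => hv.2
  refine ⟨f, hf, hfx, le_antisymm hle ?_⟩
  suffices htop : Submodule.span ℝ (insert x {v | v ∈ S ∧ f v = 0}) = ⊤ by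
    intro y hy
    obtain ⟨a, z, hz, rfl⟩ := Submodule.mem_span_insert.1 (htop ▸ Submodule.mem_top : y ∈ _)
    have hz' : f z = 0 := hle hz
    have hy' : f (a • x + z) = 0 := hy
    rw [map_add, map_smul, hz', add_zero, smul_eq_mul] at hy'
    rw [(mul_eq_zero.1 hy').resolve_right hfx.ne', zero_smul, zero_add]
    exact hz
  by_contra hne
  -- Tilting f along d changes neither its value at x nor its zeros among the generators; the sign
  -- of d is then arranged so that the tilt reaches a new zero.
  obtain ⟨d, hd0, hd⟩ := Submodule.exists_le_ker_of_lt_top _ (lt_top_iff_ne_top.2 hne)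
  have hdx : d x = 0 := hd (Submodule.subset_span (Set.mem_insert _ _))
  have hdT {v : Mink} (hv : v ∈ S) (hfv : f v = 0) : d v = 0 :=
    hd (Submodule.subset_span (Set.mem_insert_of_mem _ ⟨hv, hfv⟩))
  obtain ⟨d, hdx, hdT, v₀, hv₀, hdv₀⟩ : ∃ d : Mink →ₗ[ℝ] ℝ, d x = 0 ∧
      (∀ v ∈ S, f v = 0 → d v = 0) ∧ ∃ v ∈ S, 0 < d v := by
    by_cases hpos : ∃ v ∈ S, 0 < d v
    · exact ⟨d, hdx, fun v => hdT, hpos⟩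
    · refine ⟨-d, by simp [hdx], fun v hv h => by simp [hdT hv h], ?_⟩
      by_contra hneg
      push Not at hpos hneg
      refine hd0 (LinearMap.ext_on hS fun v hv => ?_)
      exact le_antisymm (hpos v hv) (by simpa using hneg v hv)
  -- Ratio test: t is the largest parameter for which f + t d is still nonpositive on S, and w
  -- becomes a new zero.
  obtain ⟨w, hw, hwmin⟩ := Finset.exists_min_image (S.filter fun v => 0 < d v)
    (fun v => -f v / d v) ⟨v₀, Finset.mem_filter.2 ⟨hv₀, hdv₀⟩⟩
  rw [Finset.mem_filter] at hw
  set t := -f w / d w with ht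
  have ht0 : 0 ≤ t := div_nonneg (by linarith [hf w hw.1]) hw.2.le
  refine hmin (f + t • d) ⟨fun v hv => ?_, by simpa [hdx] using hfx⟩ ?_
  · simp only [LinearMap.add_apply, LinearMap.smul_apply, smul_eq_mul]
    rcases le_or_gt (d v) 0 with hdv | hdv
    · linarith [hf v hv, mul_nonpos_of_nonneg_of_nonpos ht0 hdv]
    · have := hwmin v (Finset.mem_filter.2 ⟨hv, hdv⟩)
      rw [le_div_iff₀ hdv] at this
      linarith
  · change (S.filter fun v => (f + t • d) v ≠ 0).card < (S.filter fun v => f v ≠ 0).card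
    apply Finset.card_lt_card
    rw [Finset.ssubset_iff_of_subset]
    · refine ⟨w, Finset.mem_filter.2 ⟨hw.1, fun h => hw.2.ne' (hdT w hw.1 h)⟩, ?_⟩
      rw [Finset.mem_filter, not_and, not_not]
      intro _
      simp only [LinearMap.add_apply, LinearMap.smul_apply, smul_eq_mul, ht]
      rw [div_mul_cancel₀ _ hw.2.ne']
      ring
    · intro v hv
      rw [Finset.mem_filter] at hv ⊢
      refine ⟨hv.1, fun h => hv.2 ?_⟩
      simp [h, hdT v hv.1 h]

/-- Future lightlike vectors that are not proportional have negative product. -/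
theorem mink_neg_of_lightlike {v w : Mink} (hv : mink v v = 0) (hv0 : 0 < v 0) (hw : mink w w = 0)
    (hw0 : 0 < w 0) (h : w ∉ Submodule.span ℝ {v}) : mink v w < 0 := by
  have hne : v 0 • w - w 0 • v ≠ 0 := by
    intro h0
    apply h
    rw [Submodule.mem_span_singleton]
    refine ⟨(v 0)⁻¹ * w 0, ?_⟩
    rw [mul_smul, ← sub_eq_zero.1 h0, smul_smul, inv_mul_cancel₀ hv0.ne', one_smul]
  have hpos : 0 < mink (v 0 • w - w 0 • v) (v 0 • w - w 0 • v) := by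
    refine mink_self_pos_of_orthogonal (u := ![1, 0, 0, 0]) (by simp [mink]) ?_ hne
    simp [mink]
    ring
  simp only [mink_sub_left, mink_sub_right, mink_smul_left, mink_smul_right, hv, hw,
    mink_comm w v] at hpos
  have := mul_pos hv0 hw0
  by_contra hcon
  nlinarith [mul_nonneg this.le (not_lt.1 hcon)]

theorem exists_spacelike_smul {e : Mink} (he : 0 < mink e e) :
    ∃ (e' : Spacelike) (c : ℝ), 0 < c ∧ e'.1 = c • e := by
  have hc : 0 < (Real.sqrt (mink e e))⁻¹ := inv_pos.2 (Real.sqrt_pos.2 he)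
  refine ⟨⟨(Real.sqrt (mink e e))⁻¹ • e, ?_⟩, _, hc, rfl⟩
  rw [mink_smul_left, mink_smul_right, ← mul_assoc, ← mul_inv, Real.mul_self_sqrt he.le,
    inv_mul_cancel₀ he.ne']

/-- An interior point lies off the boundary of every half-space containing the set. -/
theorem mink_neg_of_mem_interior {P : Set H3} {z : H3} (hz : z ∈ interior P) {e : Spacelike}
    (he : P ⊆ halfSpace e) : mink z.1 e.1 < 0 := by
  refine lt_of_le_of_ne (he (interior_subset hz)) fun h0 => ?_
  have hs (t : ℝ) : 0 < 1 + t ^ 2 := by positivity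
  have h1 (t : ℝ) : mink (Real.sqrt (1 + t ^ 2) • z.1 + t • e.1)
      (Real.sqrt (1 + t ^ 2) • z.1 + t • e.1) = -1 := by
    simp only [mink_add_left, mink_add_right, mink_smul_left, mink_smul_right, mink_self_H3, h0,
      mink_comm e.1 z.1, e.2]
    have := Real.mul_self_sqrt (hs t).le
    linear_combination -this
  have h2 (t : ℝ) : 0 < (Real.sqrt (1 + t ^ 2) • z.1 + t • e.1) 0 := by
    refine future_of_mink_neg (x := z) (by rw [h1]; norm_num) ?_
    rw [mink_add_left, mink_smul_left, mink_smul_left, mink_self_H3, mink_comm e.1, h0]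
    have := Real.sqrt_pos.2 (hs t)
    linarith
  let γ : ℝ → H3 := fun t => ⟨Real.sqrt (1 + t ^ 2) • z.1 + t • e.1, h1 t, h2 t⟩
  have hγ : Continuous γ := Continuous.subtype_mk (by fun_prop) _
  have hγ0 : γ 0 = z := Subtype.ext (by simp [γ])
  have hev : ∀ᶠ t in nhds (0 : ℝ), γ t ∈ interior P :=
    hγ.continuousAt.eventually_mem (by rw [hγ0]; exact isOpen_interior.mem_nhds hz)
  obtain ⟨t, ht, ht0⟩ := ((hev.filter_mono (nhdsWithin_le_nhds (s := Set.Ioi 0))).and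
    self_mem_nhdsWithin).exists
  have h3 : mink (γ t).1 e.1 ≤ 0 := he (interior_subset ht)
  simp only [γ, mink_add_left, mink_smul_left, h0, e.2] at h3
  have : 0 < t := ht0
  linarith

section Ideal

variable {P : Set H3} {S : Finset Mink} {z : H3}

/-- If the generators lay in a hyperplane e^⊥, it would contain the timelike z, so e would be
spacelike and P would lie in a plane, leaving no interior. -/
theorem span_eq_top_of_mem_interior (hP : ∀ x : H3, x ∈ P ↔ x.1 ∈ nonnegSpan S)
    (hz : z ∈ interior P) : Submodule.span ℝ (S : Set Mink) = ⊤ := by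
  by_contra hne
  obtain ⟨f, hf0, hf⟩ := Submodule.exists_le_ker_of_lt_top _ (lt_top_iff_ne_top.2 hne)
  obtain ⟨e, rfl⟩ := exists_minkForm_eq f
  have hP0 (x : H3) (hx : x ∈ P) : mink x.1 e = 0 := by
    obtain ⟨c, -, hc⟩ := (hP x).1 hx
    rw [hc]
    exact hf (Submodule.sum_mem _ fun v hv =>
      Submodule.smul_mem _ _ (Submodule.subset_span hv))
  have he : e ≠ 0 := by
    rintro rfl
    exact hf0 (LinearMap.ext fun x => by simp [mink])
  obtain ⟨e', c, hc, he'⟩ := exists_spacelike_smul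
    (mink_self_pos_of_orthogonal (mink_self_H3_neg z) (hP0 z (interior_subset hz)) he)
  have h1 : mink z.1 e'.1 < 0 := mink_neg_of_mem_interior hz fun x hx => by
    change mink x.1 e'.1 ≤ 0
    rw [he', mink_smul_right, hP0 x hx, mul_zero]
  rw [he', mink_smul_right, hP0 z (interior_subset hz), mul_zero] at h1
  exact lt_irrefl 0 h1

/-- A point outside an ideal polyhedron is separated from it by the plane of a face. -/
theorem exists_faceNormal_pos (hS : ∀ v ∈ S, mink v v = 0 ∧ 0 < v 0)
    (hP : ∀ x : H3, x ∈ P ↔ x.1 ∈ nonnegSpan S) (hz : z ∈ interior P) {x : H3} (hx : x ∉ P) :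
    ∃ e ∈ faceNormals P, 0 < mink x.1 e.1 := by
  rw [hP] at hx
  obtain ⟨f, hf, hfx, hspan⟩ := exists_facet_form (span_eq_top_of_mem_interior hP hz)
    (exists_separating_form (fun v hv => (hS v hv).2) x.2.2 hx)
  obtain ⟨e, rfl⟩ := exists_minkForm_eq f
  simp only [minkForm_apply] at hf hfx hspan
  have hne : e ≠ 0 := by
    rintro rfl
    simp [mink] at hfx
  have hrank := finrank_ker_minkForm hne
  -- The facet has dimension 3, so it contains two nonproportional lightlike generators. Their sum
  -- is timelike and orthogonal to e, which forces e to be spacelike.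
  obtain ⟨v, hv⟩ : ∃ v, v ∈ S ∧ mink v e = 0 := by
    by_contra hcon
    push Not at hcon
    have : {v | v ∈ S ∧ mink v e = 0} = ∅ := Set.eq_empty_of_forall_notMem fun v hv =>
      hcon v hv.1 hv.2
    rw [← hspan, this, Submodule.span_empty, finrank_bot] at hrank
    omega
  obtain ⟨w, hw, hwv⟩ : ∃ w, (w ∈ S ∧ mink w e = 0) ∧ w ∉ Submodule.span ℝ {v} := by
    by_contra hcon
    push Not at hcon
    have h1 : LinearMap.ker (minkForm e) ≤ Submodule.span ℝ {v} := by
      rw [← hspan, Submodule.span_le]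
      exact fun w hw => hcon w hw
    have h2 := Submodule.finrank_mono h1
    have h3 := finrank_span_le_card (R := ℝ) ({v} : Set Mink)
    simp at h3
    omega
  have hvw : mink (v + w) (v + w) < 0 := by
    have := mink_neg_of_lightlike (hS v hv.1).1 (hS v hv.1).2 (hS w hw.1).1 (hS w hw.1).2 hwv
    simp only [mink_add_left, mink_add_right, (hS v hv.1).1, (hS w hw.1).1, mink_comm w v]
    linarith
  have hvw0 : 0 < (v + w) 0 := add_pos (hS v hv.1).2 (hS w hw.1).2
  have hvwe : mink (v + w) e = 0 := by rw [mink_add_left, hv.2, hw.2, add_zero]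
  have hvwS : v + w ∈ nonnegSpan S :=
    add_mem_nonnegSpan (mem_nonnegSpan hv.1) (mem_nonnegSpan hw.1)
  obtain ⟨e', c, hc, he'⟩ :=
    exists_spacelike_smul (mink_self_pos_of_orthogonal hvw hvwe hne)
  have hee' (y : Mink) : mink y e'.1 = c * mink y e := by rw [he', mink_smul_right]
  have hface {y : Mink} (hy : mink y y < 0) (hy0 : 0 < y 0) (hye : mink y e = 0)
      (hyS : y ∈ nonnegSpan S) :
      y ∈ Submodule.span ℝ ((fun x : H3 => x.1) '' face P e') := by
    obtain ⟨q, a, ha, hq⟩ := exists_normalize hy hy0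
    have hqP : q ∈ face P e' := by
      refine ⟨(hP q).2 ?_, ?_⟩
      · rw [hq]; exact smul_mem_nonnegSpan hyS ha.le
      · change mink q.1 e'.1 = 0
        rw [hee', hq, mink_smul_left, hye, mul_zero, mul_zero]
    have : y = a⁻¹ • q.1 := by rw [hq, smul_smul, inv_mul_cancel₀ ha.ne', one_smul]
    rw [this]
    exact Submodule.smul_mem _ _ (Submodule.subset_span ⟨q, hqP, rfl⟩)
  refine ⟨e', ⟨fun y hy => ?_, ?_⟩, ?_⟩
  · change mink y.1 e'.1 ≤ 0
    rw [hee']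
    exact mul_nonpos_of_nonneg_of_nonpos hc.le
      (map_nonpos_of_mem_nonnegSpan (f := minkForm e) hf ((hP y).1 hy))
  · suffices Submodule.span ℝ ((fun x : H3 => x.1) '' face P e') = LinearMap.ker (minkForm e) by
      rw [this, hrank]
    apply le_antisymm
    · refine (span_face_le P e').trans fun y hy => ?_
      have : c * mink y e = 0 := (hee' y).symm.trans hy
      exact (mul_eq_zero.1 this).resolve_left hc.ne'
    · rw [← hspan, Submodule.span_le]
      intro u hu
      -- A lightlike u is not a point of the face, but it is the difference of v + w + u and v + w,
      -- both of which are proportional to such points.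
      have h1 := hface hvw hvw0 hvwe hvwS
      have h2 := hface (timelike_add hvw hvw0 (hS u hu.1).1.le (hS u hu.1).2)
        (add_pos hvw0 (hS u hu.1).2) (by rw [mink_add_left, hvwe, hu.2, add_zero])
        (add_mem_nonnegSpan hvwS (mem_nonnegSpan hu.1))
      have h3 := Submodule.sub_mem _ h2 h1
      rwa [add_sub_cancel_left] at h3
  · rw [hee']
    exact mul_pos hc hfx

/-- The ray z + s v is represented by points of P for all s > 0, and for large s the sign of its
product with e is governed by v. -/
theorem mink_nonpos_of_subset_halfSpace (hS : ∀ v ∈ S, mink v v = 0 ∧ 0 < v 0)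
    (hP : ∀ x : H3, x ∈ P ↔ x.1 ∈ nonnegSpan S) (hz : z ∈ P) {e : Spacelike}
    (he : P ⊆ halfSpace e) {v : Mink} (hv : v ∈ S) : mink v e.1 ≤ 0 := by
  have key (s : ℝ) (hs : 0 < s) : mink z.1 e.1 + s * mink v e.1 ≤ 0 := by
    have hsv : mink (s • v) (s • v) ≤ 0 := by
      rw [mink_smul_left, mink_smul_right, (hS v hv).1]; simp
    have hsv0 : 0 < (s • v) 0 := mul_pos hs (hS v hv).2
    obtain ⟨q, a, ha, hq⟩ := exists_normalize (v := z.1 + s • v)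
      (timelike_add (mink_self_H3_neg z) z.2.2 hsv hsv0) (add_pos z.2.2 hsv0)
    have hqP : q ∈ P := by
      rw [hP, hq]
      exact smul_mem_nonnegSpan (add_mem_nonnegSpan ((hP z).1 hz)
        (smul_mem_nonnegSpan (mem_nonnegSpan hv) hs.le)) ha.le
    have h1 : mink q.1 e.1 ≤ 0 := he hqP
    rw [hq, mink_smul_left, mink_add_left, mink_smul_left] at h1
    exact nonpos_of_mul_nonpos_right h1 ha
  by_contra hcon
  push Not at hcon
  have h0 : mink z.1 e.1 ≤ 0 := he hz
  have h1 := key ((1 - mink z.1 e.1) / mink v e.1) (div_pos (by linarith) hcon)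
  rw [div_mul_cancel₀ _ hcon.ne'] at h1
  linarith

/-- A face is determined by the generators on its plane, and there are finitely many subsets of S.
-/
theorem finite_faceNormals (hS : ∀ v ∈ S, mink v v = 0 ∧ 0 < v 0)
    (hP : ∀ x : H3, x ∈ P ↔ x.1 ∈ nonnegSpan S) (hz : z ∈ interior P) :
    (faceNormals P).Finite := by
  classical
  refine Set.Finite.of_finite_image
    (f := fun e : Spacelike => S.filter fun v => mink v e.1 = 0)
    ((Finset.finite_toSet S.powerset).subset ?_) ?_
  · rintro _ ⟨e, -, rfl⟩
    exact Finset.mem_coe.2 (Finset.mem_powerset.2 (Finset.filter_subset _ _))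
  · intro e he e' he' hee'
    have hee' : (S.filter fun v => mink v e.1 = 0) = S.filter fun v => mink v e'.1 = 0 := hee'
    refine (eq_of_face_subset_wall he (fun x hx => ?_) (interior_subset hz)
      (mink_neg_of_mem_interior hz he'.1)).symm
    obtain ⟨c, hc, hxc⟩ := (hP x).1 hx.1
    have h0 : mink x.1 e.1 = 0 := hx.2
    rw [hxc, mink_sum_left, Finset.sum_eq_zero_iff_of_nonpos] at h0
    · change mink x.1 e'.1 = 0
      rw [hxc, mink_sum_left]
      refine Finset.sum_eq_zero fun v hv => ?_
      have h1 := h0 v hv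
      rw [mink_smul_left] at h1 ⊢
      rcases mul_eq_zero.1 h1 with h2 | h2
      · rw [h2, zero_mul]
      · have : v ∈ S.filter fun v => mink v e'.1 = 0 := by
          rw [← hee']
          exact Finset.mem_filter.2 ⟨hv, h2⟩
        rw [(Finset.mem_filter.1 this).2, mul_zero]
    · intro v hv
      rw [mink_smul_left]
      exact mul_nonpos_of_nonneg_of_nonpos (hc v hv)
        (mink_nonpos_of_subset_halfSpace hS hP (interior_subset hz) he.1 hv)

end Ideal

/-! ### Right-angled polyhedra are chambers -/

section RightAngled

variable {P : Set H3} {z : H3}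

/-- The relative interior of a face. -/
theorem exists_mem_face_strict (hfin : (faceNormals P).Finite)
    (hP : ∀ x, x ∈ P ↔ ∀ e ∈ faceNormals P, mink x.1 e.1 ≤ 0)
    (hz : ∀ e ∈ faceNormals P, mink z.1 e.1 < 0) {e : Spacelike} (he : e ∈ faceNormals P) :
    ∃ w ∈ face P e, ∀ a ∈ faceNormals P \ {e}, mink w.1 a.1 < 0 := by
  refine exists_common_strict (hfin.subset Set.sdiff_subset) (face_nonempty he)
    (face_convex_of_mem_iff e hP) (fun x hx a ha => ha.1.1 hx.1) fun a ha => ?_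
  by_contra hcon
  push Not at hcon
  exact ha.2 (eq_of_face_subset_wall he (fun x hx => le_antisymm (ha.1.1 hx.1) (hcon x hx))
    ((hP z).2 fun b hb => (hz b hb).le) (hz a ha.1))

/-- Within its plane, a face is cut out by the adjacent faces. -/
theorem mem_of_adjacent (hfin : (faceNormals P).Finite)
    (hP : ∀ x, x ∈ P ↔ ∀ e ∈ faceNormals P, mink x.1 e.1 ≤ 0)
    (hz : ∀ e ∈ faceNormals P, mink z.1 e.1 < 0) {e : Spacelike} (he : e ∈ faceNormals P) {y : H3}
    (hye : mink y.1 e.1 = 0) (hy : ∀ a ∈ faceNormals P, Adjacent P e a → mink y.1 a.1 ≤ 0) :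
    y ∈ P := by
  by_contra hcon
  rw [hP] at hcon
  push Not at hcon
  obtain ⟨b₀, hb₀, hyb₀⟩ := hcon
  -- On the way from a relatively interior point w of the face to y, the first wall b to be reached
  -- belongs to a face adjacent to e, and y violates it.
  obtain ⟨w, hw, hwF⟩ := exists_mem_face_strict hfin hP hz he
  have hwe : mink w.1 e.1 = 0 := hw.2
  obtain ⟨b, ⟨hb, hyb⟩, hbmin⟩ := Set.exists_min_image {a | a ∈ faceNormals P ∧ 0 < mink y.1 a.1}
    (fun a => -mink w.1 a.1 / mink y.1 a.1) (hfin.subset fun a ha => ha.1) ⟨b₀, hb₀, hyb₀⟩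
  have hbe : b ≠ e := by
    rintro rfl
    exact hyb.ne' hye
  have ht : 0 < -mink w.1 b.1 / mink y.1 b.1 := div_pos (by linarith [hwF b ⟨hb, hbe⟩]) hyb
  set t := -mink w.1 b.1 / mink y.1 b.1 with ht_def
  obtain ⟨q, c, hc, hq⟩ := exists_normalize_add w y ht.le
  have hqP : q ∈ P := by
    rw [hP]
    intro a ha
    rw [hq, mink_smul_left, mink_add_left, mink_smul_left]
    refine mul_nonpos_of_nonneg_of_nonpos hc.le ?_
    rcases le_or_gt (mink y.1 a.1) 0 with hya | hya
    · have : mink w.1 a.1 ≤ 0 := ha.1 hw.1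
      nlinarith
    · have := hbmin a ⟨ha, hya⟩
      rw [le_div_iff₀ hya] at this
      linarith
  have hqe : mink q.1 e.1 = 0 := by
    rw [hq, mink_smul_left, mink_add_left, mink_smul_left, hwe, hye]; ring
  have hqb : mink q.1 b.1 = 0 := by
    rw [hq, mink_smul_left, mink_add_left, mink_smul_left, ht_def, div_mul_cancel₀ _ hyb.ne']
    ring
  exact absurd (hy b hb ⟨hbe.symm, q, ⟨hqP, hqe⟩, hqP, hqb⟩) (not_le.2 hyb)

/-- The faces of a right-angled polyhedron form no acute exterior angles. -/
theorem mink_faceNormals_nonpos (hfin : (faceNormals P).Finite)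
    (hP : ∀ x, x ∈ P ↔ ∀ e ∈ faceNormals P, mink x.1 e.1 ≤ 0)
    (hz : ∀ e ∈ faceNormals P, mink z.1 e.1 < 0) (hra : IsRightAngled P) {e e' : Spacelike}
    (he : e ∈ faceNormals P) (he' : e' ∈ faceNormals P) (hne : e ≠ e') :
    mink e.1 e'.1 ≤ 0 := by
  -- Project a relatively interior point x of the face e' to the plane of e. The faces adjacent to e
  -- are orthogonal to it, so their inequalities survive and the foot y lies in P. Now ⟨y, e'⟩ ≤ 0
  -- reads ⟨x, e⟩⟨e, e'⟩ ≥ 0, where ⟨x, e⟩ < 0.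
  obtain ⟨x, hx, hxF⟩ := exists_mem_face_strict hfin hP hz he'
  have hxe : mink x.1 e.1 < 0 := hxF e ⟨he, hne⟩
  have hxe' : mink x.1 e'.1 = 0 := hx.2
  have h1 : mink (x.1 - mink x.1 e.1 • e.1) (x.1 - mink x.1 e.1 • e.1) < 0 := by
    simp only [mink_sub_left, mink_sub_right, mink_smul_left, mink_smul_right, e.2, mink_self_H3]
    rw [mink_comm e.1]
    nlinarith [sq_nonneg (mink x.1 e.1)]
  have h2 : 0 < (x.1 - mink x.1 e.1 • e.1) 0 := by
    refine future_of_mink_neg (x := x) h1.le ?_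
    rw [mink_sub_left, mink_smul_left, mink_self_H3, mink_comm e.1]
    nlinarith [sq_nonneg (mink x.1 e.1)]
  obtain ⟨y, c, hc, hy⟩ := exists_normalize h1 h2
  have hyP : y ∈ P := by
    refine mem_of_adjacent hfin hP hz he ?_ fun a ha hadj => ?_
    · rw [hy, mink_smul_left, mink_sub_left, mink_smul_left, e.2]; ring
    · rw [hy, mink_smul_left, mink_sub_left, mink_smul_left, hra e he a ha hadj]
      have : mink x.1 a.1 ≤ 0 := ha.1 hx.1
      exact mul_nonpos_of_nonneg_of_nonpos hc.le (by linarith)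
  have h3 : mink y.1 e'.1 ≤ 0 := he'.1 hyP
  rw [hy, mink_smul_left, mink_sub_left, mink_smul_left, hxe'] at h3
  have h4 := nonpos_of_mul_nonpos_right h3 hc
  by_contra hcon
  nlinarith

/-- The planes of two faces of a right-angled polyhedron are orthogonal or disjoint. -/
theorem mink_faceNormals_pair (hfin : (faceNormals P).Finite)
    (hP : ∀ x, x ∈ P ↔ ∀ e ∈ faceNormals P, mink x.1 e.1 ≤ 0)
    (hz : ∀ e ∈ faceNormals P, mink z.1 e.1 < 0) (hra : IsRightAngled P) {e e' : Spacelike}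
    (he : e ∈ faceNormals P) (he' : e' ∈ faceNormals P) (hne : e ≠ e') :
    mink e.1 e'.1 = 0 ∨ mink e.1 e'.1 ≤ -1 := by
  by_cases hcon : mink e.1 e'.1 ≤ -1
  · exact Or.inr hcon
  left
  push Not at hcon
  have hnp := mink_faceNormals_nonpos hfin hP hz hra he he' hne
  set k := mink e.1 e'.1 with hk
  have hk' : mink e'.1 e.1 = k := by rw [mink_comm]
  have hD : 0 < 1 - k ^ 2 := by nlinarith
  have hp := hz e he
  have hp' := hz e' he'
  set p := mink z.1 e.1 with hp_def
  set p' := mink z.1 e'.1 with hp'_def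
  -- Up to the factor 1 - k² > 0, the orthogonal projection of z to e^⊥ ∩ e'^⊥. The coefficients p -
  -- k p' and p' - k p are nonpositive, as are the products with the other normals, so v represents
  -- a point of P and the two faces meet.
  set v := (1 - k ^ 2) • z.1 - (p - k * p') • e.1 - (p' - k * p) • e'.1 with hv
  have hve : mink v e.1 = 0 := by
    simp only [hv, mink_sub_left, mink_smul_left, e.2, hk', ← hp_def]; ring
  have hve' : mink v e'.1 = 0 := by
    simp only [hv, mink_sub_left, mink_smul_left, e'.2, ← hk, ← hp'_def]; ring
  have ha : p - k * p' ≤ 0 := by nlinarith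
  have hb : p' - k * p ≤ 0 := by nlinarith
  have hvz : mink v z.1 < 0 := by
    simp only [hv, mink_sub_left, mink_smul_left, mink_self_H3, mink_comm e.1 z.1,
      mink_comm e'.1 z.1, ← hp_def, ← hp'_def]
    nlinarith [mul_nonneg_of_nonpos_of_nonpos ha hp.le, mul_nonneg_of_nonpos_of_nonpos hb hp'.le]
  have hvv : mink v v < 0 := by
    have : mink v v = (1 - k ^ 2) * mink v z.1 := by
      nth_rw 2 [hv]
      rw [mink_sub_right, mink_sub_right, mink_smul_right, mink_smul_right, mink_smul_right, hve,
        hve']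
      ring
    rw [this]
    exact mul_neg_of_pos_of_neg hD hvz
  obtain ⟨y, c, hc, hy⟩ := exists_normalize hvv (future_of_mink_neg hvv.le hvz)
  have hye : mink y.1 e.1 = 0 := by rw [hy, mink_smul_left, hve, mul_zero]
  have hye' : mink y.1 e'.1 = 0 := by rw [hy, mink_smul_left, hve', mul_zero]
  have hyP : y ∈ P := by
    rw [hP]
    intro a hamem
    by_cases hae : a = e
    · rw [hae, hye]
    by_cases hae' : a = e'
    · rw [hae', hye']
    have h1 := mink_faceNormals_nonpos hfin hP hz hra he hamem (Ne.symm hae)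
    have h2 := mink_faceNormals_nonpos hfin hP hz hra he' hamem (Ne.symm hae')
    rw [hy, mink_smul_left]
    refine mul_nonpos_of_nonneg_of_nonpos hc.le ?_
    simp only [hv, mink_sub_left, mink_smul_left]
    nlinarith [mul_nonneg_of_nonpos_of_nonpos ha h1, mul_nonneg_of_nonpos_of_nonpos hb h2,
      mul_pos_of_neg_of_neg (hz a hamem) (neg_neg_of_pos hD)]
  exact hra e he e' he' ⟨hne, y, ⟨hyP, hye⟩, hyP, hye'⟩

end RightAngled

/-- A right-angled ideal polyhedron is a chamber. -/
theorem exists_isChamber {P : Set H3} (hP : IsIdealPolyhedron P) (hra : IsRightAngled P) :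
    ∃ x₀, IsChamber (faceNormals P) P x₀ := by
  obtain ⟨⟨z, hz⟩, S, hS, hPS⟩ := hP
  have hPS' (x : H3) : x ∈ P ↔ x.1 ∈ nonnegSpan S := hPS x
  have hfin := finite_faceNormals hS hPS' hz
  have hmem (x : H3) : x ∈ P ↔ ∀ e ∈ faceNormals P, mink x.1 e.1 ≤ 0 := by
    refine ⟨fun hx e he => he.1 hx, fun hx => ?_⟩
    by_contra hcon
    obtain ⟨e, he, hxe⟩ := exists_faceNormal_pos hS hPS' hz hcon
    exact absurd (hx e he) (not_le.2 hxe)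
  have hbase (e : Spacelike) (he : e ∈ faceNormals P) : mink z.1 e.1 < 0 :=
    mink_neg_of_mem_interior hz he.1
  exact ⟨z, hfin, hmem, fun e he e' he' hne => mink_faceNormals_pair hfin hmem hbase hra he he' hne,
    hbase⟩

/-! ### Topology of hyperbolic space -/

/-- The time coordinate cannot vanish when ⟨x, x⟩ = -1, so the strict inequality may be replaced by
a closed one. -/
theorem isClosed_hyperboloid : IsClosed {x : Mink | mink x x = -1 ∧ 0 < x 0} := by
  have : {x : Mink | mink x x = -1 ∧ 0 < x 0} = {x | mink x x = -1} ∩ {x | 0 ≤ x 0} := by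
    ext x
    refine ⟨fun h => ⟨h.1, h.2.le⟩, fun h => ⟨h.1, lt_of_le_of_ne h.2 fun h0 => ?_⟩⟩
    have h1 : mink x x = -1 := h.1
    simp only [mink, ← h0] at h1
    nlinarith [sq_nonneg (x 1), sq_nonneg (x 2), sq_nonneg (x 3)]
  rw [this]
  exact (isClosed_eq (continuous_mink continuous_id continuous_id) continuous_const).inter
    (isClosed_le continuous_const (continuous_apply 0))

instance : LocallyCompactSpace H3 :=
  isClosed_hyperboloid.isClosedEmbedding_subtypeVal.locallyCompactSpace

/-- The vertical projection of the hyperboloid to the spatial coordinates. -/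
def spatialHomeomorph : H3 ≃ₜ ℝ × ℝ × ℝ where
  toFun x := (x.1 1, x.1 2, x.1 3)
  invFun y := ⟨![Real.sqrt (1 + y.1 ^ 2 + y.2.1 ^ 2 + y.2.2 ^ 2), y.1, y.2.1, y.2.2], by
    have h : 0 < 1 + y.1 ^ 2 + y.2.1 ^ 2 + y.2.2 ^ 2 := by positivity
    refine ⟨?_, by simpa using h⟩
    simp [mink, Real.mul_self_sqrt h.le]
    ring⟩
  left_inv x := by
    obtain ⟨x, hx, hx0⟩ := x
    apply Subtype.ext
    have h : 1 + x 1 ^ 2 + x 2 ^ 2 + x 3 ^ 2 = x 0 ^ 2 := by simp only [mink] at hx; linarith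
    ext i
    fin_cases i
    · simp [h, Real.sqrt_sq hx0.le]
    all_goals simp
  right_inv y := by simp
  continuous_toFun := by
    have (i : Fin 4) : Continuous fun x : H3 => x.1 i :=
      (continuous_apply i).comp continuous_subtype_val
    exact (this 1).prodMk ((this 2).prodMk (this 3))
  continuous_invFun := by
    refine Continuous.subtype_mk (continuous_pi fun i => ?_) _
    fin_cases i <;> simp <;> fun_prop

instance : ContractibleSpace H3 := spatialHomeomorph.contractibleSpace

theorem continuous_of_mem_isometries {g : Equiv.Perm H3} (hg : g ∈ isometries) : Continuous g := by
  obtain ⟨L, hL⟩ := hg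
  refine Continuous.subtype_mk (f := fun x => L x.1) ?_ (fun x => hL.2 x ▸ (g x).2) |>.congr
    fun x => Subtype.ext (hL.2 x).symm
  exact (LinearMap.continuous_of_finiteDimensional (L : Mink →ₗ[ℝ] Mink)).comp
    continuous_subtype_val

/-! ### Discreteness of the reflection group -/

theorem mink_one_le_sq (x y : H3) : 1 ≤ mink x.1 y.1 ^ 2 := by
  have h := mink_self_nonneg_of_orthogonal (u := y.1) (e := x.1 + mink x.1 y.1 • y.1)
    (mink_self_H3_neg y)
    (by rw [mink_add_right, mink_smul_right, mink_self_H3, mink_comm y.1 x.1]; ring)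
  simp only [mink_add_left, mink_add_right, mink_smul_left, mink_smul_right, mink_self_H3,
    mink_comm y.1 x.1] at h
  linarith

/-- A multiplicative triangle inequality for the hyperbolic cosine of the distance. -/
theorem neg_mink_le (x y z : H3) : -mink x.1 z.1 ≤ 2 * (mink x.1 y.1 * mink y.1 z.1) := by
  have hxy := mink_H3_neg x y
  have hyz := mink_H3_neg y z
  have hpos := mul_pos_of_neg_of_neg hxy hyz
  have h := mink_cauchy_of_orthogonal (u := y.1) (a := x.1 + mink x.1 y.1 • y.1)
    (b := z.1 + mink y.1 z.1 • y.1) (mink_self_H3_neg y)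
    (by rw [mink_add_right, mink_smul_right, mink_self_H3, mink_comm y.1 x.1]; ring)
    (by rw [mink_add_right, mink_smul_right, mink_self_H3]; ring)
  simp only [mink_add_left, mink_add_right, mink_smul_left, mink_smul_right, mink_self_H3,
    mink_comm z.1 y.1, mink_comm y.1 x.1] at h
  have hx := mink_one_le_sq x y
  have hz := mink_one_le_sq y z
  have h' : (mink x.1 z.1 + mink x.1 y.1 * mink y.1 z.1) ^ 2
      ≤ (mink x.1 y.1 * mink y.1 z.1) ^ 2 := by nlinarith
  linarith [(abs_le_of_sq_le_sq' h' hpos.le).1]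

/-- A point closer to `x₀` than a hyperplane lies on the same side of it as `x₀`. -/
theorem mink_neg_of_close {x₀ y : H3} {e : Spacelike} (he : mink x₀.1 e.1 < 0)
    (hy : mink x₀.1 y.1 ^ 2 < 1 + mink x₀.1 e.1 ^ 2) : mink y.1 e.1 < 0 := by
  have hxy := mink_H3_neg x₀ y
  have h := mink_cauchy_of_orthogonal (u := x₀.1) (a := y.1 + mink x₀.1 y.1 • x₀.1)
    (b := e.1 + mink x₀.1 e.1 • x₀.1) (mink_self_H3_neg x₀)
    (by rw [mink_add_right, mink_smul_right, mink_self_H3]; ring)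
    (by rw [mink_add_right, mink_smul_right, mink_self_H3]; ring)
  simp only [mink_add_left, mink_add_right, mink_smul_left, mink_smul_right, mink_self_H3,
    mink_comm y.1 x₀.1, mink_comm e.1 x₀.1, e.2] at h
  by_contra hcon
  push Not at hcon
  have hpos := mul_pos_of_neg_of_neg hxy he
  nlinarith [mul_nonneg hcon hpos.le, sq_nonneg (mink y.1 e.1)]

theorem norm_H3_le (y : H3) : ‖y.1‖ ≤ y.1 0 := by
  have h := mink_self_H3 y
  simp only [mink] at h
  refine (pi_norm_le_iff_of_nonneg y.2.2.le).2 fun i => ?_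
  rw [Real.norm_eq_abs]
  refine abs_le_of_sq_le_sq ?_ y.2.2.le
  fin_cases i <;> simp <;>
    nlinarith [sq_nonneg (y.1 1), sq_nonneg (y.1 2), sq_nonneg (y.1 3)]

theorem mink_self_le_norm (v : Mink) : mink v v ≤ 3 * ‖v‖ ^ 2 := by
  have h (i : Fin 4) : v i ^ 2 ≤ ‖v‖ ^ 2 := by
    have := norm_le_pi_norm v i
    rw [Real.norm_eq_abs] at this
    exact sq_le_sq' (by linarith [neg_abs_le (v i)]) (by linarith [le_abs_self (v i)])
  have h1 := h 1
  have h2 := h 2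
  have h3 := h 3
  simp only [mink]
  nlinarith [sq_nonneg (v 0)]

namespace IsChamber

variable {F : Set Spacelike} {P : Set H3} {x₀ : H3}

/-- A translate of x₀ closer to x₀ than every wall is still in the chamber. Here ⟨x₀, g x₀⟩² is
cosh² of the distance and ⟨x₀, e⟩² is sinh² of the distance to the wall. -/
theorem exists_pos_eq_one (h : IsChamber F P x₀) : ∃ ε > 0,
    ∀ g ∈ Subgroup.closure (reflection '' F), mink x₀.1 (g x₀).1 ^ 2 < 1 + ε → g = 1 := by
  have hev : ∀ᶠ ε in nhds (0 : ℝ), ∀ e ∈ F, ε < mink x₀.1 e.1 ^ 2 :=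
    (Filter.eventually_all_finite h.finite).2 fun e he =>
      eventually_lt_nhds (sq_pos_of_neg (h.base e he))
  obtain ⟨ε, hε, hε0⟩ := ((hev.filter_mono (nhdsWithin_le_nhds (s := Set.Ioi 0))).and
    self_mem_nhdsWithin).exists
  refine ⟨ε, hε0, fun g hg hgx => h.eq_one_of_apply_mem hg ((h.mem_iff _).2 fun e he => ?_)⟩
  exact (mink_neg_of_close (h.base e he) (by linarith [hε e he])).le

/-- The orbit of the base point is uniformly discrete. -/
theorem exists_pos_le_dist (h : IsChamber F P x₀) : ∃ δ > 0,
    ∀ a ∈ Subgroup.closure (reflection '' F), ∀ b ∈ Subgroup.closure (reflection '' F), a ≠ b →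
      δ ≤ dist (a x₀).1 (b x₀).1 := by
  obtain ⟨ε, hε, hone⟩ := h.exists_pos_eq_one
  have hs : 1 < Real.sqrt (1 + ε) := by
    rw [Real.lt_sqrt zero_le_one]; linarith
  have hr : 0 < 2 * (Real.sqrt (1 + ε) - 1) / 3 := by linarith
  -- The constant comes from ⟨a - b, a - b⟩ = 2(-⟨a, b⟩ - 1), which is at most 3 times the squared
  -- sup norm of a - b.
  refine ⟨Real.sqrt (2 * (Real.sqrt (1 + ε) - 1) / 3), Real.sqrt_pos.2 hr, fun a ha b hb hab => ?_⟩
  have h1 : 1 + ε ≤ mink (a x₀).1 (b x₀).1 ^ 2 := by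
    by_contra hcon
    push Not at hcon
    have h2 : mink x₀.1 ((a⁻¹ * b) x₀).1 = mink (a x₀).1 (b x₀).1 := by
      rw [← mink_isometry (closure_reflections_le F ha), ← Equiv.Perm.mul_apply,
        mul_inv_cancel_left]
    exact hab (inv_mul_eq_one.1 (hone (a⁻¹ * b) (mul_mem (inv_mem ha) hb) (by rwa [h2])))
  have h3 : Real.sqrt (1 + ε) ≤ -mink (a x₀).1 (b x₀).1 := by
    rw [Real.sqrt_le_left (by linarith [mink_H3_neg (a x₀) (b x₀)])]
    linarith
  have h4 : mink ((a x₀).1 - (b x₀).1) ((a x₀).1 - (b x₀).1)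
      = -2 - 2 * mink (a x₀).1 (b x₀).1 := by
    simp only [mink_sub_left, mink_sub_right, mink_self_H3, mink_comm (b x₀).1 (a x₀).1]
    ring
  have h5 := mink_self_le_norm ((a x₀).1 - (b x₀).1)
  rw [dist_eq_norm, Real.sqrt_le_left (norm_nonneg _)]
  linarith

/-- If g k ∈ L with k ∈ K, the triangle inequality through g k bounds the time coordinate of g x₀,
hence its norm; a uniformly discrete orbit meets a ball in a finite set. -/
theorem finite_setOf_image_inter (h : IsChamber F P x₀) {K L : Set H3} (hK : IsCompact K)
    (hL : IsCompact L) : {g : Subgroup.closure (reflection '' F) |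
      ((fun x => g.1 x) '' K ∩ L).Nonempty}.Finite := by
  obtain ⟨δ, hδ, hsep⟩ := h.exists_pos_le_dist
  let : TopologicalSpace (Subgroup.closure (reflection '' F)) := ⊥
  have : DiscreteTopology (Subgroup.closure (reflection '' F)) := ⟨rfl⟩
  have hemb : Topology.IsClosedEmbedding
      fun g : Subgroup.closure (reflection '' F) => (g.1 x₀).1 :=
    Metric.isClosedEmbedding_of_pairwise_le_dist hδ fun a b hab =>
      hsep a.1 a.2 b.1 b.2 fun hh => hab (Subtype.ext hh)
  obtain ⟨C₁, hC₁⟩ := hK.exists_bound_of_continuousOn (f := fun x : H3 => mink x₀.1 x.1)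
    (continuous_mink continuous_const continuous_subtype_val).continuousOn
  obtain ⟨C₂, hC₂⟩ := hL.exists_bound_of_continuousOn (f := fun x : H3 => x.1 0)
    ((continuous_apply 0).comp continuous_subtype_val).continuousOn
  have hcpt := hemb.isCompact_preimage (isCompact_closedBall (0 : Mink) (2 * (C₁ * C₂)))
  refine (isCompact_iff_finite.1 hcpt).subset ?_
  rintro g ⟨_, ⟨k, hk, rfl⟩, hl⟩
  let o : H3 := ⟨![1, 0, 0, 0], by simp [mink]⟩
  have ho (y : H3) : mink y.1 o.1 = -y.1 0 := by simp [o, mink]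
  have h1 := neg_mink_le (g.1 x₀) (g.1 k) o
  rw [mink_isometry (closure_reflections_le F g.2), ho, ho, neg_neg] at h1
  have h2 := hC₁ k hk
  have h3 := hC₂ _ hl
  rw [Real.norm_eq_abs, abs_of_neg (mink_H3_neg _ _)] at h2
  rw [Real.norm_eq_abs, abs_of_pos (g.1 k).2.2] at h3
  rw [Set.mem_preimage, mem_closedBall_zero_iff]
  refine (norm_H3_le (g.1 x₀)).trans (h1.trans ?_)
  have h4 : -mink x₀.1 k.1 * (g.1 k).1 0 ≤ C₁ * C₂ :=
    mul_le_mul h2 h3 (g.1 k).2.2.le ((neg_pos.2 (mink_H3_neg _ _)).le.trans h2)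
  linarith

/-- A group acting freely inside the reflection group of a chamber acts as a group of deck
transformations. -/
theorem isQuotientCoveringMap_proj (h : IsChamber F P x₀) {Γ : Subgroup (Equiv.Perm H3)}
    (hΓ : Γ ≤ Subgroup.closure (reflection '' F)) (hfree : ActsFreely Γ) :
    IsQuotientCoveringMap (proj Γ) Γ := by
  have : ContinuousConstSMul Γ H3 :=
    ⟨fun g => continuous_of_mem_isometries (closure_reflections_le F (hΓ g.2))⟩
  have : ProperlyDiscontinuousSMul Γ H3 := by
    refine ⟨fun {K L} hK hL => ?_⟩
    refine ((h.finite_setOf_image_inter hK hL).preimage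
      (Subgroup.inclusion_injective hΓ).injOn).subset fun g hg => hg
  have : IsCancelSMul Γ H3 :=
    isCancelSMul_iff_eq_one_of_smul_eq.2 fun g x hgx => Subtype.ext (hfree g.1 g.2 x hgx)
  exact isQuotientCoveringMap_quotientMk_of_properlyDiscontinuousSMul

end IsChamber

/-! ### Intermediate covers and fundamental groups -/

theorem ActsFreely.mono {Γ' Γ : Subgroup (Equiv.Perm H3)} (h : Γ' ≤ Γ) (hΓ : ActsFreely Γ) :
    ActsFreely Γ' := fun g hg => hΓ g (h hg)

theorem proj_eq_iff {Γ : Subgroup (Equiv.Perm H3)} {x y : H3} :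
    proj Γ x = proj Γ y ↔ ∃ g ∈ Γ, g y = x :=
  Quotient.eq''.trans ⟨fun ⟨g, hg⟩ => ⟨g.1, g.2, hg⟩, fun ⟨g, hg, h⟩ => ⟨⟨g, hg⟩, h⟩⟩

theorem proj_surjective (Γ : Subgroup (Equiv.Perm H3)) : Function.Surjective (proj Γ) :=
  Quotient.mk_surjective

theorem continuous_proj (Γ : Subgroup (Equiv.Perm H3)) : Continuous (proj Γ) :=
  continuous_quot_mk

@[simp] theorem coverMap_proj {Γ' Γ : Subgroup (Equiv.Perm H3)} (h : Γ' ≤ Γ) (x : H3) :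
    coverMap h (proj Γ' x) = proj Γ x := rfl

/-- Over the image of an open set U disjoint from its nontrivial Γ-translates, the sheets are the
images in the intermediate quotient of the translates g U. -/
theorem isCoveringMap_coverMap {Γ' Γ : Subgroup (Equiv.Perm H3)} (h : Γ' ≤ Γ)
    (hp : IsQuotientCoveringMap (proj Γ) Γ) : IsCoveringMap (coverMap h) := by
  have hcont (g : Equiv.Perm H3) (hg : g ∈ Γ) : Continuous g := hp.continuous_const_smul ⟨g, hg⟩
  have hopen : IsOpenMap (proj Γ) := hp.isOpenQuotientMap.isOpenMap
  have hopen' : IsOpenMap (proj Γ') := by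
    have : ContinuousConstSMul Γ' H3 := ⟨fun g => hcont g.1 (h g.2)⟩
    exact isOpenMap_quotient_mk'_mul
  have hcover : IsOpenMap (coverMap h) := by
    intro A hA
    have : coverMap h '' A = proj Γ '' (proj Γ' ⁻¹' A) := by
      ext y
      constructor
      · rintro ⟨a, ha, rfl⟩
        obtain ⟨x, rfl⟩ := proj_surjective Γ' a
        exact ⟨x, ha, rfl⟩
      · rintro ⟨x, hx, rfl⟩
        exact ⟨proj Γ' x, hx, rfl⟩
    rw [this]
    exact hopen _ (hA.preimage (continuous_proj Γ'))
  intro y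
  obtain ⟨x, rfl⟩ := proj_surjective Γ y
  obtain ⟨U₀, hU₀, hdisj₀⟩ := hp.disjoint x
  set U := interior U₀
  have hxU : x ∈ U := mem_interior_iff_mem_nhds.2 hU₀
  have hdisj {g : Equiv.Perm H3} (hg : g ∈ Γ) {u v : H3} (hu : u ∈ U) (hv : v ∈ U)
      (huv : g u = v) : g = 1 := congrArg Subtype.val
    (hdisj₀ ⟨g, hg⟩ ⟨v, ⟨u, interior_subset hu, huv⟩, interior_subset hv⟩)
  have heq {u v : H3} (hu : u ∈ U) (hv : v ∈ U) (huv : proj Γ u = proj Γ v) : u = v := by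
    obtain ⟨g, hg, rfl⟩ := proj_eq_iff.1 huv
    rw [hdisj hg hv hu rfl, Equiv.Perm.one_apply]
  have hproj {g : Equiv.Perm H3} (hg : g ∈ Γ) (u : H3) : proj Γ (g u) = proj Γ u :=
    proj_eq_iff.2 ⟨g, hg, rfl⟩
  -- Indexing by the images instead of by g merges translates differing by an element of Γ', so that
  -- distinct indices give disjoint sheets.
  let ι := Set.range fun g : Γ => proj Γ' '' (g.1 '' U)
  let : TopologicalSpace ι := ⊥
  have : DiscreteTopology ι := ⟨rfl⟩
  have : Nonempty (HypQuotient Γ → HypQuotient Γ') := ⟨fun _ => proj Γ' x⟩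
  have : Nonempty ι := ⟨⟨_, 1, rfl⟩⟩
  have hVopen : IsOpen (proj Γ '' U) := hopen _ isOpen_interior
  have hsurj (i : ι) : Set.SurjOn (coverMap h) i.1 (proj Γ '' U) := by
    obtain ⟨_, g, rfl⟩ := i
    rintro _ ⟨u, hu, rfl⟩
    exact ⟨proj Γ' (g.1 u), ⟨_, ⟨u, hu, rfl⟩, rfl⟩, hproj g.2 u⟩
  have hiopen (i : ι) : IsOpen i.1 := by
    obtain ⟨_, g, rfl⟩ := i
    apply hopen'
    have : g.1 '' U = (g⁻¹).1 ⁻¹' U := Equiv.image_eq_preimage_symm g.1 U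
    rw [this]
    exact isOpen_interior.preimage (hcont _ (g⁻¹).2)
  let t := IsOpen.trivializationDiscrete (f := coverMap h) (fun i : ι => i.1) (proj Γ '' U) hVopen
    (fun i W hW => ⟨fun hWo => (hWo.preimage (coverMap h).continuous).inter (hiopen i),
      fun hWo => by
        have h1 := hcover _ hWo
        rwa [Set.image_preimage_inter, Set.inter_eq_left.2 (hW.trans (hsurj i))] at h1⟩)
    (by
      rintro ⟨_, g, rfl⟩ _ ⟨_, ⟨u, hu, rfl⟩, rfl⟩ _ ⟨_, ⟨v, hv, rfl⟩, rfl⟩ huv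
      rw [coverMap_proj, coverMap_proj, hproj g.2, hproj g.2] at huv
      rw [heq hu hv huv])
    hsurj
    (by
      rintro ⟨_, a, rfl⟩ ⟨_, b, rfl⟩ hne
      refine Set.disjoint_left.2 ?_
      rintro _ ⟨_, ⟨u, hu, rfl⟩, rfl⟩ ⟨_, ⟨v, hv, rfl⟩, huv⟩
      obtain ⟨c, hc, hcu⟩ := proj_eq_iff.1 huv
      refine hne (Subtype.ext ?_)
      have h1 : b.1⁻¹ * c * a.1 = 1 := by
        refine hdisj (mul_mem (mul_mem (inv_mem b.2) (h hc)) a.2) hu hv ?_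
        rw [Equiv.Perm.mul_apply, Equiv.Perm.mul_apply, hcu, ← Equiv.Perm.mul_apply,
          inv_mul_cancel, Equiv.Perm.one_apply]
      have h2 : b.1 = c * a.1 := by
        rw [mul_assoc] at h1
        exact inv_mul_eq_one.1 h1
      change proj Γ' '' (a.1 '' U) = proj Γ' '' (b.1 '' U)
      rw [h2, Equiv.Perm.coe_mul, Set.image_comp, Set.image_image (proj Γ') c]
      refine Set.image_congr fun w _ => ?_
      exact proj_eq_iff.2 ⟨c⁻¹, inv_mem hc, by
        rw [← Equiv.Perm.mul_apply, inv_mul_cancel, Equiv.Perm.one_apply]⟩)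
    (by
      intro q hq
      obtain ⟨w, rfl⟩ := proj_surjective Γ' q
      obtain ⟨u, hu, huw⟩ := hq
      obtain ⟨g, hg, rfl⟩ := proj_eq_iff.1 huw.symm
      exact Set.mem_iUnion.2 ⟨⟨_, ⟨g, hg⟩, rfl⟩, _, ⟨u, hu, rfl⟩, rfl⟩)
  exact .to_isEvenlyCovered_preimage (.of_trivialization (t := t) ⟨x, hxU, rfl⟩)

/-- The image of a loop under the natural map between two quotients. -/
def coverLoop {Γ' Γ : Subgroup (Equiv.Perm H3)} (h : Γ' ≤ Γ) {x : H3}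
    (δ : Path (proj Γ' x) (proj Γ' x)) : Path (proj Γ x) (proj Γ x) where
  toFun s := coverMap h (δ s)
  continuous_toFun := (coverMap h).continuous.comp δ.continuous
  source' := congrArg (coverMap h) δ.source
  target' := congrArg (coverMap h) δ.target

theorem mapOfEq_coverMap {Γ' Γ : Subgroup (Equiv.Perm H3)} (h : Γ' ≤ Γ) {x : H3}
    (δ : Path (proj Γ' x) (proj Γ' x)) :
    FundamentalGroup.mapOfEq (coverMap h) (x := proj Γ' x) (y := proj Γ x) rfl
      (FundamentalGroup.fromPath (.mk δ)) = FundamentalGroup.fromPath (.mk (coverLoop h δ)) :=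
  FundamentalGroup.mapOfEq_apply ..

theorem mem_coverPi1 {Γ' Γ : Subgroup (Equiv.Perm H3)} (h : Γ' ≤ Γ) {x : H3}
    {γ : FundamentalGroup (HypQuotient Γ) (proj Γ x)} :
    γ ∈ coverPi1 h x ↔ ∃ δ : Path (proj Γ' x) (proj Γ' x),
      FundamentalGroup.fromPath (.mk (coverLoop h δ)) = γ := by
  constructor
  · rintro ⟨δ, rfl⟩
    obtain ⟨p, hp⟩ := Path.Homotopic.Quotient.mk_surjective (FundamentalGroup.toPath δ)
    exact ⟨p, (mapOfEq_coverMap h p).symm.trans (congrArg _ hp)⟩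
  · rintro ⟨δ, rfl⟩
    exact ⟨_, mapOfEq_coverMap h δ⟩

/-- A loop lifts to a loop in an intermediate cover if and only if its deck transformation
belongs to the corresponding subgroup. -/
theorem mem_coverPi1_iff {Γ' Γ : Subgroup (Equiv.Perm H3)} (h : Γ' ≤ Γ)
    (hp : IsQuotientCoveringMap (proj Γ) Γ) (hp' : IsQuotientCoveringMap (proj Γ') Γ') (x : H3)
    (γ : FundamentalGroup (HypQuotient Γ) (proj Γ x)) :
    γ ∈ coverPi1 h x ↔ (hp.fundamentalGroupToMulOpposite ⟨x, rfl⟩ γ).unop.1 ∈ Γ' := by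
  rw [mem_coverPi1]
  have hgx : (hp.fundamentalGroupToMulOpposite ⟨x, rfl⟩ γ).unop.1 x =
      (hp.isCoveringMap.monodromy γ ⟨x, rfl⟩).1 :=
    hp.unop_fundamentalGroupToMulOpposite_smul (e := ⟨x, rfl⟩)
  generalize (hp.fundamentalGroupToMulOpposite ⟨x, rfl⟩ γ).unop = g at hgx
  have hlift (p : Path (proj Γ x) (proj Γ x)) :
      (hp.isCoveringMap.monodromy (.mk p) ⟨x, rfl⟩).1 =
        hp.isCoveringMap.liftPath p x p.source 1 := rfl
  constructor
  · rintro ⟨δ, rfl⟩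
    set q := hp'.isCoveringMap.liftPath δ x δ.source with hq
    have hlifts := hp'.isCoveringMap.liftPath_lifts δ x δ.source
    have hq1 : proj Γ' (q 1) = proj Γ' x := (congrFun hlifts 1).trans δ.target
    obtain ⟨g', hg', hg'x⟩ := proj_eq_iff.1 hq1
    -- A lift of δ to `H3` also lifts its image in the smaller quotient, so by uniqueness of lifts
    -- both have the same endpoint.
    have : q = hp.isCoveringMap.liftPath (coverLoop h δ) x (coverLoop h δ).source :=
      (IsCoveringMap.eq_liftPath_iff' ..).2
        ⟨funext fun s => congrArg (coverMap h) (congrFun hlifts s),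
          hp'.isCoveringMap.liftPath_zero _ _ _⟩
    suffices g = ⟨g', h hg'⟩ by rw [this]; exact hg'
    refine hp.isCancelSMul.right_cancel _ _ x ?_
    change g.1 x = g' x
    rw [hg'x, this]
    exact hgx.trans (hlift _)
  · intro hgΓ
    obtain ⟨p, hpγ⟩ := Path.Homotopic.Quotient.mk_surjective (FundamentalGroup.toPath γ)
    change _ = γ at hpγ
    subst hpγ
    set q := hp.isCoveringMap.liftPath p x p.source with hq
    have hq1 : q 1 = g.1 x := ((hgx.trans (hlift p))).symm
    let δ : Path (proj Γ' x) (proj Γ' x) :=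
      { toFun := fun s => proj Γ' (q s)
        continuous_toFun := (continuous_proj Γ').comp q.continuous
        source' := congrArg (proj Γ') (hp.isCoveringMap.liftPath_zero _ _ _)
        target' := by
          rw [hq1]
          exact proj_eq_iff.2 ⟨g.1, hgΓ, rfl⟩ }
    refine ⟨δ, congrArg Path.Homotopic.Quotient.mk (Path.ext (funext fun s => ?_))⟩
    exact congrFun (hp.isCoveringMap.liftPath_lifts p x p.source) s

theorem exists_fundamentalGroup_equiv {ι : Type} {Γ : Subgroup (Equiv.Perm H3)}
    {Γ' : ι → Subgroup (Equiv.Perm H3)} (h : ∀ i, Γ' i ≤ Γ)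
    (hp : IsQuotientCoveringMap (proj Γ) Γ) (hp' : ∀ i, IsQuotientCoveringMap (proj (Γ' i)) (Γ' i))
    (x : H3) : ∃ Φ : FundamentalGroup (HypQuotient Γ) (proj Γ x) ≃* Γ, ∀ i,
      (coverPi1 (h i) x).map Φ.toMonoidHom = (Γ' i).subgroupOf Γ := by
  -- Monodromy lands in the opposite group; composing with inversion restores the order of
  -- multiplication and does not affect membership in a subgroup.
  let Φ := (hp.fundamentalGroupEquiv ⟨x, rfl⟩).trans (MulEquiv.inv' Γ).symm
  have hΦ (γ) : Φ γ = (hp.fundamentalGroupToMulOpposite ⟨x, rfl⟩ γ).unop⁻¹ := rfl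
  refine ⟨Φ, fun i => ?_⟩
  ext g
  rw [Subgroup.mem_subgroupOf]
  constructor
  · rintro ⟨γ, hγ, rfl⟩
    have := (mem_coverPi1_iff (h i) hp (hp' i) x γ).1 hγ
    exact inv_mem this
  · intro hg
    refine ⟨Φ.symm g, (mem_coverPi1_iff (h i) hp (hp' i) x _).2 ?_, Φ.apply_symm_apply g⟩
    have h1 := hΦ (Φ.symm g)
    rw [Φ.apply_symm_apply] at h1
    rw [← inv_inv (MulOpposite.unop _), ← h1]
    exact inv_mem hg

/-! ### Co-finality and the main theorem -/

theorem IsCofinal.of_map {G H ι : Type} [Group G] [Group H] (Φ : G ≃* H) {K : ι → Subgroup G}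
    {K' : ι → Subgroup H} (hK : ∀ i, (K i).map Φ.toMonoidHom = K' i) (h : IsCofinal K') :
    IsCofinal K := by
  refine ⟨fun i => ⟨?_⟩, ?_⟩
  · have h1 := Subgroup.index_map_equiv (K i) Φ
    rw [← h1]
    have h2 := (h.1 i).index_ne_zero
    rwa [← hK i] at h2
  · refine (Subgroup.eq_bot_iff_forall _).2 fun g hg => ?_
    rw [Subgroup.mem_iInf] at hg
    have h1 : Φ g ∈ ⨅ i, K' i := by
      rw [Subgroup.mem_iInf]
      intro i
      rw [← hK i]
      exact ⟨g, hg i, rfl⟩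
    rw [h.2, Subgroup.mem_bot] at h1
    exact (MulEquiv.map_eq_one_iff Φ).1 h1

/-- Infinite index inside Γ would give infinite index inside the initial group, and the trivial
intersection is inherited from that group. -/
theorem Construction.isCofinal_subgroupOf (C : Construction) {x₀ : H3}
    (h : IsChamber (faceNormals (C.poly 0)) (C.poly 0) x₀) {Γ : Subgroup (Equiv.Perm H3)}
    (hΓ : Γ ≤ C.G ⟨0, 0⟩) : IsCofinal fun p : C.Idx => (C.G p).subgroupOf Γ := by
  refine ⟨fun p => ⟨fun h0 => ?_⟩, ?_⟩
  · exact C.relIndex_ne_zero h (stageStart C.k p.1 + (p.2 : ℕ))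
      (Subgroup.relIndex_eq_zero_of_le_right hΓ h0)
  · refine (Subgroup.eq_bot_iff_forall _).2 fun g hg => Subtype.ext ?_
    rw [Subgroup.mem_iInf] at hg
    have : g.1 ∈ ⨅ p : C.Idx, C.G p := Subgroup.mem_iInf.2 fun p => hg p
    rw [C.iInf_G_eq_bot h] at this
    exact this

end RAPoly

end

open RAPoly in
theorem theorem5p1 (C : Construction) :
    (⨅ p : C.Idx, C.G p) = ⊥ ∧
    ∀ Γ : Subgroup (Equiv.Perm H3), Γ ≤ C.G ⟨0, 0⟩ → (Γ.subgroupOf (C.G ⟨0, 0⟩)).FiniteIndex →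
      ActsFreely Γ →
      IsCofinal (fun p : C.Idx => (C.G p).subgroupOf Γ) ∧
      (∀ p : C.Idx, IsCoveringMap (coverMap (inf_le_left : Γ ⊓ C.G p ≤ Γ))) ∧
      ∀ x : H3,
        (∃ Φ : FundamentalGroup (HypQuotient Γ) (proj Γ x) ≃* Γ, ∀ p : C.Idx,
          (coverPi1 (inf_le_left : Γ ⊓ C.G p ≤ Γ) x).map Φ.toMonoidHom = (C.G p).subgroupOf Γ) ∧
        IsCofinal (fun p : C.Idx => coverPi1 (inf_le_left : Γ ⊓ C.G p ≤ Γ) x) := by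
  obtain ⟨x₀, h⟩ := exists_isChamber C.ideal C.rightAngled
  refine ⟨C.iInf_G_eq_bot h, fun Γ hΓ _ hfree => ?_⟩
  have hcof := C.isCofinal_subgroupOf h hΓ
  have hp : IsQuotientCoveringMap (proj Γ) Γ := h.isQuotientCoveringMap_proj hΓ hfree
  have hp' (p : C.Idx) : IsQuotientCoveringMap (proj (Γ ⊓ C.G p)) ↥(Γ ⊓ C.G p) :=
    h.isQuotientCoveringMap_proj (inf_le_left.trans hΓ) (hfree.mono inf_le_left)
  refine ⟨hcof, fun p => isCoveringMap_coverMap _ hp, fun x => ?_⟩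
  obtain ⟨Φ, hΦ⟩ := exists_fundamentalGroup_equiv (fun _ => inf_le_left) hp hp' x
  have hΦ' (p : C.Idx) : (coverPi1 (inf_le_left : Γ ⊓ C.G p ≤ Γ) x).map Φ.toMonoidHom =
      (C.G p).subgroupOf Γ := by
    rw [hΦ p, Subgroup.inf_subgroupOf_left]
  exact ⟨⟨Φ, hΦ'⟩, hcof.of_map Φ hΦ'⟩
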